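/- Consider parametric timed automata (PTA) with a single clock $x$, which takes values in $\mathbb N$, and with arbitrarily many parameters $p_0,p_1,\dots$, which take values in $\mathbb Z$. An expression is either a linear expression $c_0+\sum_j c_jp_{i_j}$ with integer coefficients or $\infty$. The invariants of the locations and the guards of the transitions are finite conjunctions of constraints $b_1x-b_2x\prec e$, where $b_1,b_2\in\{0,1\}$, $\prec\in\{<,\le,=\}$ and $e$ is an expression; a transition may reset $x:=b$ with $b\in\mathbb N$. A state property $\phi$ is a Boolean combination of such constraints and of locations. For a parameter valuation $\gamma$, the runs of $\mathcal A[\gamma]$ start in the initial location with $x=0$ and consist of time advances and transitions between states (pairs of a location and a clock value) in which the invariant of the location holds. Let $\Gamma(\mathcal A,\exists\Diamond\phi)$ be the set of the parameter valuations $\gamma$ for which some reachable state of $\mathcal A[\gamma]$ satisfies $\phi$. Then $\Gamma(\mathcal A,\exists\Diamond\phi)$ is computable. More precisely, there is one algorithm that, given any such $\mathcal A$ and $\phi$, outputs a finite list of pairs, each of which consists of a finite system of linear inequalities $\sum_i a_ip_i\ge b$ and equalities $\sum_i a_ip_i=b$ (with $a_i,b\in\mathbb Z$, in the parameters that occur in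 $\mathcal A$ or $\phi$) and of a truth value, such that: 1. the sets of integer solutions of the systems (the regions) are pairwise disjoint and cover the space of all integer parameter valuations; 2. $\Gamma(\mathcal A,\exists\Diamond\phi)$ is the union of the regions whose truth value is "true"; 3. on each region the run-feasibility formulas have constant truth value: if $\chi$ is any Boolean combination of constraints $c$ that occur in $\mathcal A$ or $\phi$ and of constraints $c[u]$ that assert such a $c$ after an update $u$ of $\mathcal A$, then either for all $\gamma$ in the region, or for no $\gamma$ in the region, there is a clock value $x\in\mathbb N$ that satisfies $\chi[\gamma]$; 4. for each syntactic run $\tau$ of $\mathcal A$ (a sequence of consecutive transitions from the initial location), the existence of a run of $\mathcal A[\gamma]$ along $\tau$ (each step being a time advance followed by the next transition of $\tau$), and the existence of such a run whose final state satisfies $\phi$, are each constant for $\gamma$ in a region. -/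

import Mathlib

/-! ### Syntax of parametric timed automata

All syntactic objects are finite data over types with a `Primcodable` instance, so that they can
be the input and the output of an algorithm (`Computable`). Clocks are indexed by `Fin n`, and the
infinite enumerable supply of parameters is `p_0, p_1, p_2, …`, indexed by `ℕ`. -/

/-- The relations `<`, `≤`, `=` that occur in constraints. -/
inductive CmpRel where
  | lt
  | le
  | eq

namespace CmpRel

def equivFin : CmpRel ≃ Fin 3 where
  toFun r := match r with
    | lt => 0
    | le => 1
    | eq => 2
  invFun i := match i with
    | 0 => lt
    | 1 => le
    | 2 => eq
  left_inv r := by cases r <;> rfl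
  right_inv i := by fin_cases i <;> rfl

instance instPrimcodable : Primcodable CmpRel := Primcodable.ofEquiv (Fin 3) equivFin

/-- The meaning of a relation symbol between extended integers. -/
def Holds (r : CmpRel) (a b : WithTop ℤ) : Prop :=
  match r with
  | lt => a < b
  | le => a ≤ b
  | eq => a = b

end CmpRel

/-- A parameter valuation: time is discrete and the parameters are integers. -/
abbrev ParamVal := ℕ → ℤ

/-- A clock valuation over `n` clocks, with time domain `ℕ`. -/
abbrev ClockVal (n : ℕ) := Fin n → ℕ

/-- A linear form `c_1 p_{i_1} + ⋯ + c_k p_{i_k}`, as the list of the pairs `(c_j, i_j)`. -/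
abbrev LinForm := List (ℤ × ℕ)

namespace LinForm

def eval (f : LinForm) (γ : ParamVal) : ℤ := (f.map fun t => t.1 * γ t.2).sum

/-- The (indices of the) parameters that occur in a linear form. -/
def params (f : LinForm) : Set ℕ := {i | ∃ t ∈ f, t.2 = i}

end LinForm

/-- A linear expression: `some (c, f)` is `c + f`, and `none` is `∞`. -/
abbrev LinExpr := Option (ℤ × LinForm)

namespace LinExpr

def eval (e : LinExpr) (γ : ParamVal) : WithTop ℤ :=
  match e with
  | some (c, f) => ((c + f.eval γ : ℤ) : WithTop ℤ)
  | none => ⊤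

def params (e : LinExpr) : Set ℕ :=
  match e with
  | some (_, f) => f.params
  | none => ∅

end LinExpr

/-- An atomic constraint `b₁ x - b₂ y ≺ e` with `b₁, b₂ ∈ {0, 1}`; the coefficient `0` is `none`. -/
structure Atom (n : ℕ) where
  left : Option (Fin n)
  right : Option (Fin n)
  rel : CmpRel
  expr : LinExpr

namespace Atom

variable {n : ℕ}

def equivProd : Atom n ≃ Option (Fin n) × Option (Fin n) × CmpRel × LinExpr where
  toFun a := (a.left, a.right, a.rel, a.expr)
  invFun p := ⟨p.1, p.2.1, p.2.2.1, p.2.2.2⟩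
  left_inv _ := rfl
  right_inv _ := rfl

instance instPrimcodable : Primcodable (Atom n) := Primcodable.ofEquiv _ equivProd

/-- The value of `b x`, which is `0` when there is no clock. -/
def clockTerm (x : Option (Fin n)) (ω : ClockVal n) : ℤ :=
  match x with
  | some i => (ω i : ℤ)
  | none => 0

/-- `(γ, ω) ⊨ a`. -/
def Holds (a : Atom n) (γ : ParamVal) (ω : ClockVal n) : Prop :=
  a.rel.Holds ((clockTerm a.left ω - clockTerm a.right ω : ℤ) : WithTop ℤ) (a.expr.eval γ)

end Atom

/-- A simple constraint: a finite conjunction of atomic constraints. -/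
abbrev Constraint (n : ℕ) := List (Atom n)

namespace Constraint

def Holds {n : ℕ} (g : Constraint n) (γ : ParamVal) (ω : ClockVal n) : Prop :=
  ∀ a ∈ g, a.Holds γ ω

end Constraint

/-- An update set: `u x = some b` is the reset `x := b`, and `none` leaves the clock unchanged. -/
abbrev UpdateSet (n : ℕ) := Fin n → Option ℕ

namespace UpdateSet

/-- The clock valuation `ω[u]`. -/
def apply {n : ℕ} (u : UpdateSet n) (ω : ClockVal n) : ClockVal n := fun x => (u x).getD (ω x)

end UpdateSet

/-- A transition `(q, g, a, u, q')`. -/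
structure Transition (n : ℕ) where
  src : ℕ
  guard : Constraint n
  act : ℕ
  upd : UpdateSet n
  tgt : ℕ

namespace Transition

variable {n : ℕ}

def equivProd : Transition n ≃ ℕ × Constraint n × ℕ × UpdateSet n × ℕ where
  toFun t := (t.src, t.guard, t.act, t.upd, t.tgt)
  invFun p := ⟨p.1, p.2.1, p.2.2.1, p.2.2.2.1, p.2.2.2.2⟩
  left_inv _ := rfl
  right_inv _ := rfl

instance instPrimcodable : Primcodable (Transition n) := Primcodable.ofEquiv _ equivProd

end Transition

/-- The data of a parametric timed automaton with `n` clocks and linear expressions. The actions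
are `0, …, numActions - 1`, the locations are `0, …, inv.length - 1`, and the entry of `inv` at
`q` is the invariant of `q`. -/
structure PTA (n : ℕ) where
  numActions : ℕ
  init : ℕ
  inv : List (Constraint n)
  trans : List (Transition n)

/-- State properties. -/
inductive StateFormula (n : ℕ) where
  | atom (a : Atom n)
  | loc (q : ℕ)
  | neg (φ : StateFormula n)
  | and (φ ψ : StateFormula n)
  | or (φ ψ : StateFormula n)

/-- Symbols of the Polish notation of state properties: atomic constraints, locations, and the
connectives `0 = ¬`, `1 = ∧`, `2 = ∨`. -/
abbrev Token (n : ℕ) := Atom n ⊕ ℕ ⊕ Fin 3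

namespace StateFormula

variable {n : ℕ}

/-- The Polish (prefix) notation of a state property, as which it is given to an algorithm. -/
def tokens : StateFormula n → List (Token n)
  | atom a => [Sum.inl a]
  | loc q => [Sum.inr (Sum.inl q)]
  | neg φ => Sum.inr (Sum.inr 0) :: tokens φ
  | and φ ψ => Sum.inr (Sum.inr 1) :: (tokens φ ++ tokens ψ)
  | or φ ψ => Sum.inr (Sum.inr 2) :: (tokens φ ++ tokens ψ)

/-- The atomic constraints that occur in a state property. -/
def atoms : StateFormula n → Set (Atom n)
  | atom a => {a}
  | loc _ => ∅
  | neg φ => atoms φ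
  | and φ ψ => atoms φ ∪ atoms ψ
  | or φ ψ => atoms φ ∪ atoms ψ

/-- Truth of a state property in the state `(q, ω)` under the parameter valuation `γ`. -/
def Holds (γ : ParamVal) (q : ℕ) (ω : ClockVal n) : StateFormula n → Prop
  | atom a => a.Holds γ ω
  | loc q' => q = q'
  | neg φ => ¬ Holds γ q ω φ
  | and φ ψ => Holds γ q ω φ ∧ Holds γ q ω ψ
  | or φ ψ => Holds γ q ω φ ∨ Holds γ q ω ψ

end StateFormula

/-! ### Semantics -/

/-- Labelled transition systems with states in `S` and labels in `Δ`. -/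
structure LTS (Δ S : Type) where
  init : Set S
  step : S → Δ → S → Prop

/-- A state is reachable if it is the last state of a (finite) run. -/
def LTS.Reachable {Δ S : Type} (L : LTS Δ S) (s : S) : Prop :=
  ∃ s₀ ∈ L.init, Relation.ReflTransGen (fun s₁ s₂ => ∃ l, L.step s₁ l s₂) s₀ s

namespace PTA

variable {n : ℕ}

def equivProd : PTA n ≃ ℕ × ℕ × List (Constraint n) × List (Transition n) where
  toFun A := (A.numActions, A.init, A.inv, A.trans)
  invFun p := ⟨p.1, p.2.1, p.2.2.1, p.2.2.2⟩
  left_inv _ := rfl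
  right_inv _ := rfl

instance instPrimcodable : Primcodable (PTA n) := Primcodable.ofEquiv _ equivProd

/-- The initial location and all transitions use only locations and actions of the automaton. -/
def WellFormed (A : PTA n) : Prop :=
  A.init < A.inv.length ∧
    ∀ t ∈ A.trans, t.src < A.inv.length ∧ t.tgt < A.inv.length ∧ t.act < A.numActions

/-- The invariant of a location. -/
def invariant (A : PTA n) (q : ℕ) : Constraint n := A.inv.getD q []

/-- `(q, ω)` is a state of `A[γ]`: the invariant of the location `q` holds. -/
def IsState (A : PTA n) (γ : ParamVal) (s : ℕ × ClockVal n) : Prop :=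
  s.1 < A.inv.length ∧ (A.invariant s.1).Holds γ s.2

/-- Time advance by `d` between states of `A[γ]`. -/
def Delay (A : PTA n) (γ : ParamVal) (d : ℕ) (s s' : ℕ × ClockVal n) : Prop :=
  A.IsState γ s ∧ A.IsState γ s' ∧ s'.1 = s.1 ∧ s'.2 = fun x => s.2 x + d

/-- The instantaneous step between states of `A[γ]` by the transition `t`. -/
def Fire (A : PTA n) (γ : ParamVal) (t : Transition n) (s s' : ℕ × ClockVal n) : Prop :=
  A.IsState γ s ∧ A.IsState γ s' ∧ t ∈ A.trans ∧ t.src = s.1 ∧ t.tgt = s'.1 ∧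
    t.guard.Holds γ s.2 ∧ s'.2 = t.upd.apply s.2

/-- The concrete semantics `A[γ]`. A label is an action (left) or a duration (right). -/
def lts (A : PTA n) (γ : ParamVal) : LTS (ℕ ⊕ ℕ) (ℕ × ClockVal n) where
  init := {s | A.IsState γ s ∧ s = (A.init, fun _ => 0)}
  step s l s' := match l with
    | Sum.inl a => ∃ t, t.act = a ∧ A.Fire γ t s s'
    | Sum.inr d => A.Delay γ d s s'

/-- `A[γ] ⊨ ∃◇φ`. -/
def SatExistsEventually (A : PTA n) (γ : ParamVal) (φ : StateFormula n) : Prop :=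
  ∃ s, (A.lts γ).Reachable s ∧ φ.Holds γ s.1 s.2

/-- The set `Γ(A, ∃◇φ)` of parameter valuations. -/
def synthesisSet (A : PTA n) (φ : StateFormula n) : Set ParamVal :=
  {γ | A.SatExistsEventually γ φ}

/-- The list `τ` of transitions of `A` is consecutive, and starts in the location `q`. -/
def IsPathFrom (A : PTA n) : ℕ → List (Transition n) → Prop
  | _, [] => True
  | q, t :: τ => t ∈ A.trans ∧ t.src = q ∧ A.IsPathFrom t.tgt τ

/-- Syntactic runs of `A`. -/
def IsSyntacticRun (A : PTA n) (τ : List (Transition n)) : Prop := A.IsPathFrom A.init τ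

/-- From `s` there is an untimed run along `τ` to `s'`: each step is a time advance followed by
the instantaneous step of the next transition of `τ`. -/
def RunAlong (A : PTA n) (γ : ParamVal) :
    (ℕ × ClockVal n) → List (Transition n) → (ℕ × ClockVal n) → Prop
  | s, [], s' => s = s'
  | s, t :: τ, s' => ∃ d s₁ s₂, A.Delay γ d s s₁ ∧ A.Fire γ t s₁ s₂ ∧ A.RunAlong γ s₂ τ s'

/-- The final states of the runs of the syntactic run `τ` under `γ`. -/
def runStates (A : PTA n) (τ : List (Transition n)) (γ : ParamVal) : Set (ℕ × ClockVal n) :=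
  {s | ∃ s₀ ∈ (A.lts γ).init, A.RunAlong γ s₀ τ s}

/-- `τ[γ] ⊨ φ`. -/
def RunSat (A : PTA n) (τ : List (Transition n)) (γ : ParamVal) (φ : StateFormula n) : Prop :=
  ∃ s ∈ A.runStates τ γ, φ.Holds γ s.1 s.2

/-- The atomic constraints that occur in `A`. -/
def atoms (A : PTA n) : Set (Atom n) :=
  {a | (∃ g ∈ A.inv, a ∈ g) ∨ ∃ t ∈ A.trans, a ∈ t.guard}

/-- The parameters that occur in `A` or in `φ`. -/
def params (A : PTA n) (φ : StateFormula n) : Set ℕ :=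
  {i | ∃ a ∈ A.atoms ∪ φ.atoms, i ∈ a.expr.params}

/-- The Boolean combinations of the constraints `c` that occur in `A` or in `φ` and of the
constraints `c[u]`, which assert `c` after an update set `u` of `A`. The run-feasibility formulas
`x ≥ 0 ∧ lb(gᵢ) ∧ up(gⱼ)`, where the `gᵢ` are the enabling conditions
`g ∧ I_q ∧ I_q'[u]` of the steps of a syntactic run, are among them. -/
inductive IsRunFormula (A : PTA n) (φ : StateFormula n) :
    (ParamVal → ClockVal n → Prop) → Prop
  | atom (a : Atom n) (ha : a ∈ A.atoms ∪ φ.atoms) :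
      IsRunFormula A φ fun γ ω => a.Holds γ ω
  | reset (a : Atom n) (ha : a ∈ A.atoms ∪ φ.atoms) (t : Transition n) (ht : t ∈ A.trans) :
      IsRunFormula A φ fun γ ω => a.Holds γ (t.upd.apply ω)
  | neg (χ : ParamVal → ClockVal n → Prop) (h : IsRunFormula A φ χ) :
      IsRunFormula A φ fun γ ω => ¬ χ γ ω
  | and (χ₁ χ₂ : ParamVal → ClockVal n → Prop)
      (h₁ : IsRunFormula A φ χ₁) (h₂ : IsRunFormula A φ χ₂) :
      IsRunFormula A φ fun γ ω => χ₁ γ ω ∧ χ₂ γ ω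
  | or (χ₁ χ₂ : ParamVal → ClockVal n → Prop)
      (h₁ : IsRunFormula A φ χ₁) (h₂ : IsRunFormula A φ χ₂) :
      IsRunFormula A φ fun γ ω => χ₁ γ ω ∨ χ₂ γ ω

end PTA

/-! ### Systems of linear inequalities and equalities -/

/-- A system: `(f, b)` in the first list is the inequality `f ≥ b`, and in the second list it is
the equality `f = b`, with integer coefficients and right hand sides. -/
abbrev LinSystem := List (LinForm × ℤ) × List (LinForm × ℤ)

namespace LinSystem

/-- The integer solutions. -/
def solutions (S : LinSystem) : Set ParamVal :=
  {γ | (∀ r ∈ S.1, r.2 ≤ r.1.eval γ) ∧ ∀ r ∈ S.2, r.1.eval γ = r.2}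

/-- The parameters that occur in a system. -/
def params (S : LinSystem) : Set ℕ :=
  {i | ∃ r, (r ∈ S.1 ∨ r ∈ S.2) ∧ i ∈ r.1.params}

end LinSystem

/-! Over the integers, an atomic constraint on the single clock `x` is determined by which of the
linear forms `e`, `e + 1`, `-e`, `-e + 1` are at most `x`, and which of them are at most `0`
(`Atom.holds_iff_test`). Let `W` consist of these thresholds, of `0` and of the reset constants. The
regions are the sign vectors of all inequalities between two members of `W`; on each region the
order of the threshold values is fixed. Inconsistent sign vectors only give empty regions, so no
integer system ever has to be solved.

Within a region only the floor of `x` matters, that is, a largest threshold below `x`: a threshold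
is at most `x` iff it is at most the floor. Passing to the floor preserves all constraints, is
monotone, so that delays remain delays, and commutes with resets, because the reset constants are
thresholds. Evaluating the floor at another valuation of the region therefore transports clock
values, runs and the truth of all formulas in question (`Corresponds.atom_iff`,
`PTA.runAlong_transfer`). This gives the constancy statements.

For the same reason, reachability can be decided in a finite graph on pairs of a location and a
threshold, whose edges are read off the sign vector alone (`PTA.absReach_iff`). The floors along a
concrete run form an abstract path; conversely, a nonnegative threshold value is itself a clock
value, so abstract paths are runs. The search is a Warshall closure, and the whole construction is
primitive recursive. -/

/-! ### Thresholds and the abstract order -/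

/-- A threshold `c + f` with which clock values are compared. -/
abbrev Threshold := ℤ × LinForm

namespace LinForm

def neg (f : LinForm) : LinForm := f.map fun t => (-t.1, t.2)

@[simp] theorem eval_nil (γ : ParamVal) : eval [] γ = 0 := rfl

@[simp] theorem eval_append (f g : LinForm) (γ : ParamVal) :
    eval (f ++ g) γ = f.eval γ + g.eval γ := by
  simp [eval]

@[simp] theorem eval_neg (f : LinForm) (γ : ParamVal) : f.neg.eval γ = -f.eval γ := by
  induction f with
  | nil => rfl
  | cons t f ih =>
    simp only [eval, neg, List.map_cons, List.sum_cons] at ih ⊢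
    rw [ih]
    ring

@[simp] theorem params_neg (f : LinForm) : f.neg.params = f.params := by
  ext i
  simp [params, neg]

@[simp] theorem params_append (f g : LinForm) :
    params (f ++ g) = f.params ∪ g.params := by
  ext i
  simp only [params, List.mem_append, Set.mem_ofPred_eq, Set.mem_union]
  grind

end LinForm

namespace Threshold

def eval (w : Threshold) (γ : ParamVal) : ℤ := w.1 + w.2.eval γ

def const (b : ℕ) : Threshold := ((b : ℤ), [])

def neg (w : Threshold) : Threshold := (-w.1, w.2.neg)

def succ (w : Threshold) : Threshold := (w.1 + 1, w.2)

/-- The inequality `w ≤ w'`. -/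
def ineq (w w' : Threshold) : LinForm × ℤ := (w'.2 ++ w.2.neg, w.1 + -w'.1)

@[simp] theorem eval_const (b : ℕ) (γ : ParamVal) : (const b).eval γ = b := by
  simp [eval, const]

@[simp] theorem eval_neg (w : Threshold) (γ : ParamVal) : w.neg.eval γ = -w.eval γ := by
  simp only [eval, neg, LinForm.eval_neg]
  ring

@[simp] theorem eval_succ (w : Threshold) (γ : ParamVal) : w.succ.eval γ = w.eval γ + 1 := by
  simp only [eval, succ]
  ring

theorem ineq_iff (w w' : Threshold) (γ : ParamVal) :
    (ineq w w').2 ≤ (ineq w w').1.eval γ ↔ w.eval γ ≤ w'.eval γ := by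
  simp only [ineq, eval, LinForm.eval_append, LinForm.eval_neg]
  constructor <;> intro h <;> linarith

end Threshold

/-! ### Sign vectors of a list of inequalities -/

namespace LinSystem

/-- The integer negation of the inequality `f ≥ b`. -/
def negIneq (r : LinForm × ℤ) : LinForm × ℤ := (r.1.neg, 1 + -r.2)

/-- Integrality of the values is what makes the negation of a weak inequality weak again: `f < b`
iff `-f ≥ 1 - b`. -/
theorem negIneq_iff (r : LinForm × ℤ) (γ : ParamVal) :
    (negIneq r).2 ≤ (negIneq r).1.eval γ ↔ ¬ r.2 ≤ r.1.eval γ := by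
  simp only [negIneq, LinForm.eval_neg]
  omega

/-- All choices of one of `r` and `¬ r` for the inequalities `r` of a list. -/
def signVectors (l : List (LinForm × ℤ)) : List (List (LinForm × ℤ)) :=
  l.foldr (fun r acc => acc.map (List.cons r) ++ acc.map (List.cons (negIneq r))) [[]]

/-- All inequalities of the list hold. -/
def Sat (S : List (LinForm × ℤ)) (γ : ParamVal) : Prop := ∀ r ∈ S, r.2 ≤ r.1.eval γ

theorem sat_cons (r : LinForm × ℤ) (S : List (LinForm × ℤ)) (γ : ParamVal) :
    Sat (r :: S) γ ↔ r.2 ≤ r.1.eval γ ∧ Sat S γ := by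
  simp [Sat]

theorem mem_solutions_iff (S : List (LinForm × ℤ)) (γ : ParamVal) :
    γ ∈ solutions (S, []) ↔ Sat S γ := by
  simp [solutions, Sat]

theorem signVectors_cons (r : LinForm × ℤ) (l : List (LinForm × ℤ)) :
    signVectors (r :: l) =
      (signVectors l).map (List.cons r) ++ (signVectors l).map (List.cons (negIneq r)) := rfl

theorem exists_sat_signVectors (l : List (LinForm × ℤ)) (γ : ParamVal) :
    ∃ S ∈ signVectors l, Sat S γ := by
  induction l with
  | nil => exact ⟨[], by simp [signVectors], by simp [Sat]⟩
  | cons r l ih =>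
    obtain ⟨S, hS, h⟩ := ih
    rw [signVectors_cons]
    by_cases hr : r.2 ≤ r.1.eval γ
    · exact ⟨r :: S, by simp [hS], (sat_cons _ _ _).2 ⟨hr, h⟩⟩
    · exact ⟨negIneq r :: S, by simp [hS], (sat_cons _ _ _).2 ⟨(negIneq_iff r γ).2 hr, h⟩⟩

/-- Two different choices disagree at some entry, where one contains `r` and the other its negation.
Repeated entries of `l` cause no trouble: the additional choices have no solutions. -/
theorem signVectors_pairwise (l : List (LinForm × ℤ)) :
    (signVectors l).Pairwise fun S S' => ∀ γ, Sat S γ → ¬ Sat S' γ := by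
  induction l with
  | nil => simp [signVectors]
  | cons r l ih =>
    rw [signVectors_cons, List.pairwise_append, List.pairwise_map, List.pairwise_map]
    refine ⟨ih.imp fun h γ h₁ h₂ => h γ ((sat_cons _ _ _).1 h₁).2 ((sat_cons _ _ _).1 h₂).2,
      ih.imp fun h γ h₁ h₂ => h γ ((sat_cons _ _ _).1 h₁).2 ((sat_cons _ _ _).1 h₂).2, ?_⟩
    intro S hS S' hS' γ h₁ h₂
    obtain ⟨S, -, rfl⟩ := List.mem_map.1 hS
    obtain ⟨S', -, rfl⟩ := List.mem_map.1 hS'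
    exact (negIneq_iff r γ).1 ((sat_cons _ _ _).1 h₂).1 ((sat_cons _ _ _).1 h₁).1

theorem mem_signVector_cases {l S : List (LinForm × ℤ)} (hS : S ∈ signVectors l) :
    (∀ r ∈ l, r ∈ S ∨ negIneq r ∈ S) ∧ ∀ r ∈ S, r ∈ l ∨ ∃ r' ∈ l, r = negIneq r' := by
  induction l generalizing S with
  | nil => simp_all [signVectors]
  | cons r l ih =>
    rw [signVectors_cons, List.mem_append, List.mem_map, List.mem_map] at hS
    rcases hS with ⟨S, hS, rfl⟩ | ⟨S, hS, rfl⟩ <;> have := ih hS <;> grind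

/-- A syntactic lookup in `S` replaces the evaluation at a solution, since `S` contains `r` or its
negation. -/
theorem mem_signVector_iff {l S : List (LinForm × ℤ)} (hS : S ∈ signVectors l) {γ : ParamVal}
    (hγ : Sat S γ) {r : LinForm × ℤ} (hr : r ∈ l) : r ∈ S ↔ r.2 ≤ r.1.eval γ := by
  refine ⟨hγ r, fun h => ((mem_signVector_cases hS).1 r hr).resolve_right fun h' => ?_⟩
  exact (negIneq_iff r γ).1 (hγ _ h') h

theorem params_signVector {l S : List (LinForm × ℤ)} (hS : S ∈ signVectors l) {P : Set ℕ}
    (hP : ∀ r ∈ l, r.1.params ⊆ P) : params (S, []) ⊆ P := by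
  rintro i ⟨r, hr, hi⟩
  simp only [List.not_mem_nil, or_false] at hr
  rcases (mem_signVector_cases hS).2 r hr with h | ⟨r', h, rfl⟩
  · exact hP r h hi
  · exact hP r' h (by simpa [negIneq] using hi)

end LinSystem

/-- Whether the system `S` contains the inequality `w ≤ w'`. -/
def Threshold.leIn (S : List (LinForm × ℤ)) (w w' : Threshold) : Bool :=
  S.any fun r => decide (r = Threshold.ineq w w')

/-- The inequalities between any two of the given thresholds. -/
def Threshold.comparisons (W : List Threshold) : List (LinForm × ℤ) :=
  W.flatMap fun w => W.map fun w' => Threshold.ineq w w'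

/-- The bridge between the algorithm, which sees only `S`, and the values at the points of the
region. -/
theorem Threshold.leIn_iff {W : List Threshold} {S : List (LinForm × ℤ)}
    (hS : S ∈ LinSystem.signVectors (Threshold.comparisons W)) {γ : ParamVal}
    (hγ : LinSystem.Sat S γ) {w w' : Threshold} (hw : w ∈ W) (hw' : w' ∈ W) :
    Threshold.leIn S w w' = true ↔ w.eval γ ≤ w'.eval γ := by
  have : Threshold.ineq w w' ∈ Threshold.comparisons W := by
    simp only [Threshold.comparisons, List.mem_flatMap, List.mem_map]
    exact ⟨w, hw, w', hw', rfl⟩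
  rw [← Threshold.ineq_iff, ← LinSystem.mem_signVector_iff hS hγ this]
  simp [Threshold.leIn]

/-! ### Atomic constraints in terms of thresholds -/

namespace CmpRel

/-- `v ≺ e`, from the truth values of `e ≤ v` and `e + 1 ≤ v`. -/
def upper (r : CmpRel) (x y : Bool) : Bool :=
  match r with
  | lt => !x
  | le => !y
  | eq => x && !y

/-- `-v ≺ e`, from the truth values of `-e ≤ v` and `-e + 1 ≤ v`. -/
def lower (r : CmpRel) (x y : Bool) : Bool :=
  match r with
  | lt => y
  | le => x
  | eq => x && !y

/-- `v ≺ ∞`. -/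
def finite (r : CmpRel) : Bool :=
  match r with
  | lt => true
  | le => true
  | eq => false

end CmpRel

namespace Atom

/-- The thresholds that determine the truth value of an atomic constraint. -/
def thresholds {n : ℕ} (a : Atom n) : List Threshold :=
  match a.expr with
  | some e => [e, Threshold.succ e, Threshold.neg e, Threshold.succ (Threshold.neg e)]
  | none => []

/-- The truth value of an atomic constraint from those of `e ≤ x`, `e + 1 ≤ x`, `-e ≤ x`,
`-e + 1 ≤ x`, `e ≤ 0` and `e + 1 ≤ 0`. -/
def combine (l r : Option (Fin 1)) (c : CmpRel) (x₁ x₂ x₃ x₄ x₅ x₆ : Bool) : Bool :=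
  match l, r with
  | some _, none => c.upper x₁ x₂
  | none, some _ => c.lower x₃ x₄
  -- With one clock, `x - x` and the absence of clocks both give the left-hand side `0`.
  | _, _ => c.upper x₅ x₆

/-- The truth value of an atomic constraint, where `p w` is that of `w ≤ x` and `z w` is that of
`w ≤ 0`. -/
def test (p z : Threshold → Bool) (a : Atom 1) : Bool :=
  match a.expr with
  | some e => combine a.left a.right a.rel (p e) (p (Threshold.succ e)) (p (Threshold.neg e))
      (p (Threshold.succ (Threshold.neg e))) (z e) (z (Threshold.succ e))
  | none => a.rel.finite

theorem test_congr {p z p' z' : Threshold → Bool} {a : Atom 1}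
    (hp : ∀ w ∈ a.thresholds, p w = p' w) (hz : ∀ w ∈ a.thresholds, z w = z' w) :
    a.test p z = a.test p' z' := by
  rcases a with ⟨l, r, c, _ | e⟩
  · rfl
  · simp only [thresholds, List.forall_mem_cons] at hp hz
    simp only [test, hp, hz]

theorem holds_iff_test (a : Atom 1) (γ : ParamVal) (ω : ClockVal 1) :
    a.Holds γ ω ↔ a.test (fun w => decide (w.eval γ ≤ ω 0)) (fun w => decide (w.eval γ ≤ 0)) := by
  rcases a with ⟨l, r, c, _ | e⟩
  · cases c
    · simp only [Holds, LinExpr.eval, CmpRel.Holds, test, CmpRel.finite]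
      exact iff_of_true (WithTop.coe_lt_top _) trivial
    · simp [Holds, LinExpr.eval, CmpRel.Holds, test, CmpRel.finite]
    · simp only [Holds, LinExpr.eval, CmpRel.Holds, test, CmpRel.finite]
      exact iff_of_false (WithTop.coe_ne_top) (by simp)
  · have he : LinExpr.eval (some e) γ = ((Threshold.eval e γ : ℤ) : WithTop ℤ) := rfl
    simp only [Holds, test, he, Threshold.eval_succ, Threshold.eval_neg]
    generalize Threshold.eval e γ = v
    rcases l with _ | i <;> rcases r with _ | j <;> cases c <;>
      simp only [CmpRel.Holds, combine, clockTerm, CmpRel.upper, CmpRel.lower, WithTop.coe_lt_coe,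
        WithTop.coe_le_coe, WithTop.coe_inj, Fin.fin_one_eq_zero, Bool.and_eq_true,
        Bool.not_eq_true', decide_eq_true_eq, decide_eq_false_iff_not] <;> omega

/-- The truth value of an atomic constraint at the clock value `w`, according to the system. -/
def absHolds (S : List (LinForm × ℤ)) (w : Threshold) (a : Atom 1) : Bool :=
  a.test (fun v => Threshold.leIn S v w) (fun v => Threshold.leIn S v (Threshold.const 0))

end Atom

/-! ### Evaluation of state properties in Polish notation -/

namespace StateFormula

/-- One step of the evaluation of the Polish notation, with a stack of truth values. -/
def stackStep (S : List (LinForm × ℤ)) (q : ℕ) (w : Threshold) (k : Token 1) (st : List Bool) :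
    List Bool :=
  Sum.casesOn k (fun a => a.absHolds S w :: st) fun k => Sum.casesOn k
    (fun q' => decide (q = q') :: st) fun c =>
      if c = 0 then (!st.headI) :: st.tail
      else if c = 1 then (st.headI && st.tail.headI) :: st.tail.tail
      else (st.headI || st.tail.headI) :: st.tail.tail

/-- The truth value, in the abstract state `(q, w)`, of a state property in Polish notation. -/
def absHolds (S : List (LinForm × ℤ)) (q : ℕ) (w : Threshold) (l : List (Token 1)) : Bool :=
  (l.foldr (stackStep S q w) []).headI

/-- The right fold reads the prefix notation backwards, so the value of the left operand ends up on
top of that of the right one. The stack `st` below is arbitrary because the left operand is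
evaluated on a nonempty stack. -/
theorem foldr_stackStep {S : List (LinForm × ℤ)} {q : ℕ} {w : Threshold} {γ : ParamVal}
    {ω : ClockVal 1} (φ : StateFormula 1)
    (h : ∀ a ∈ φ.atoms, a.absHolds S w = true ↔ a.Holds γ ω) (st : List Bool) :
    ∃ b : Bool, φ.tokens.foldr (stackStep S q w) st = b :: st ∧ (b = true ↔ φ.Holds γ q ω) := by
  induction φ generalizing st with
  | atom a => exact ⟨_, rfl, h a rfl⟩
  | loc q' => exact ⟨_, rfl, by simp [Holds]⟩
  | neg φ ih =>
    obtain ⟨b, h₁, h₂⟩ := ih h st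
    refine ⟨!b, ?_, by simp [Holds, ← h₂]⟩
    simp [tokens, h₁, stackStep]
  | and φ ψ ih₁ ih₂ =>
    obtain ⟨b₂, h₁, h₂⟩ := ih₂ (fun a ha => h a (Or.inr ha)) st
    obtain ⟨b₁, h₃, h₄⟩ := ih₁ (fun a ha => h a (Or.inl ha)) (b₂ :: st)
    refine ⟨b₁ && b₂, ?_, by simp [Holds, ← h₂, ← h₄]⟩
    simp [tokens, h₁, h₃, stackStep]
  | or φ ψ ih₁ ih₂ =>
    obtain ⟨b₂, h₁, h₂⟩ := ih₂ (fun a ha => h a (Or.inr ha)) st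
    obtain ⟨b₁, h₃, h₄⟩ := ih₁ (fun a ha => h a (Or.inl ha)) (b₂ :: st)
    refine ⟨b₁ || b₂, ?_, by simp [Holds, ← h₂, ← h₄]⟩
    simp [tokens, h₁, h₃, stackStep]

theorem absHolds_iff {S : List (LinForm × ℤ)} {q : ℕ} {w : Threshold} {γ : ParamVal}
    {ω : ClockVal 1} (φ : StateFormula 1)
    (h : ∀ a ∈ φ.atoms, a.absHolds S w = true ↔ a.Holds γ ω) :
    absHolds S q w φ.tokens = true ↔ φ.Holds γ q ω := by
  obtain ⟨b, h₁, h₂⟩ := foldr_stackStep (q := q) φ h []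
  simp [absHolds, h₁, h₂]

/-- The atomic constraints in a list of tokens. -/
def tokenAtoms (l : List (Token 1)) : List (Atom 1) :=
  l.flatMap fun k => Sum.casesOn k (fun a => [a]) fun _ => []

theorem mem_tokenAtoms (φ : StateFormula 1) (a : Atom 1) :
    a ∈ tokenAtoms φ.tokens ↔ a ∈ φ.atoms := by
  induction φ with
  | atom b => simp [tokens, tokenAtoms, atoms]
  | loc q => simp [tokens, tokenAtoms, atoms]
  | neg φ ih => simpa [tokens, tokenAtoms, atoms] using ih
  | and φ ψ ih₁ ih₂ =>
    simp only [tokenAtoms, tokens, atoms, List.flatMap_cons, List.flatMap_append, List.mem_append,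
      Set.mem_union, List.nil_append] at ih₁ ih₂ ⊢
    rw [ih₁, ih₂]
  | or φ ψ ih₁ ih₂ =>
    simp only [tokenAtoms, tokens, atoms, List.flatMap_cons, List.flatMap_append, List.mem_append,
      Set.mem_union, List.nil_append] at ih₁ ih₂ ⊢
    rw [ih₁, ih₂]

end StateFormula

/-! ### Transitive closure -/

section Closure

variable {α : Type}

/-- The pairs of elements of `U` that satisfy `r`. -/
def pairsOf (U : List α) (r : α → α → Bool) : List (α × α) :=
  U.flatMap fun a => U.flatMap fun b => bif r a b then [(a, b)] else []

theorem mem_pairsOf {U : List α} {r : α → α → Bool} {a b : α} :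
    (a, b) ∈ pairsOf U r ↔ a ∈ U ∧ b ∈ U ∧ r a b = true := by
  simp only [pairsOf, List.mem_flatMap]
  constructor
  · rintro ⟨c, hc, d, hd, h⟩
    cases h' : r c d <;> simp_all
  · rintro ⟨ha, hb, h⟩
    exact ⟨a, ha, b, hb, by simp [h]⟩

variable [DecidableEq α]

/-- The reflexive transitive closure of `r` on `U`, with intermediate elements in `vs`. -/
def closureVia (U : List α) (r : α → α → Bool) (vs : List α) : List (α × α) :=
  vs.foldr
    (fun v acc => pairsOf U fun a b =>
      decide ((a, b) ∈ acc) || (decide ((a, v) ∈ acc) && decide ((v, b) ∈ acc)))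
    (pairsOf U fun a b => decide (a = b) || r a b)

theorem mem_closureVia_nil {U : List α} {r : α → α → Bool} {a b : α} :
    (a, b) ∈ closureVia U r [] ↔ a ∈ U ∧ b ∈ U ∧ (a = b ∨ r a b = true) := by
  simp [closureVia, mem_pairsOf]

theorem mem_closureVia_cons {U : List α} {r : α → α → Bool} {v : α} {vs : List α} {a b : α} :
    (a, b) ∈ closureVia U r (v :: vs) ↔ a ∈ U ∧ b ∈ U ∧
      ((a, b) ∈ closureVia U r vs ∨
        (a, v) ∈ closureVia U r vs ∧ (v, b) ∈ closureVia U r vs) := by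
  rw [closureVia, List.foldr_cons, mem_pairsOf]
  simp [closureVia]

theorem mem_of_mem_closureVia {U : List α} {r : α → α → Bool} {vs : List α} {a b : α}
    (h : (a, b) ∈ closureVia U r vs) : a ∈ U ∧ b ∈ U := by
  cases vs with
  | nil => exact ⟨(mem_closureVia_nil.1 h).1, (mem_closureVia_nil.1 h).2.1⟩
  | cons v vs => exact ⟨(mem_closureVia_cons.1 h).1, (mem_closureVia_cons.1 h).2.1⟩

/-- Warshall's invariant. If `u` is the newly admitted `v`, then the parts from `a` to `v` and from
`v` to `b` are already in the old closure; otherwise the parts join at `u` by induction, or the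
detour through `v` suffices. -/
theorem closureVia_trans {U : List α} {r : α → α → Bool} {vs : List α} {a u b : α}
    (hu : u ∈ vs) (h₁ : (a, u) ∈ closureVia U r vs) (h₂ : (u, b) ∈ closureVia U r vs) :
    (a, b) ∈ closureVia U r vs := by
  induction vs generalizing a u b with
  | nil => simp at hu
  | cons v vs ih =>
    rw [mem_closureVia_cons] at h₁ h₂ ⊢
    refine ⟨h₁.1, h₂.2.1, ?_⟩
    rcases List.mem_cons.1 hu with rfl | hu
    · right
      exact ⟨h₁.2.2.elim id And.left, h₂.2.2.elim id And.right⟩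
    · rcases h₁.2.2 with h₁ | ⟨h₁, h₁'⟩ <;> rcases h₂.2.2 with h₂ | ⟨h₂, h₂'⟩
      · exact Or.inl (ih hu h₁ h₂)
      · exact Or.inr ⟨ih hu h₁ h₂, h₂'⟩
      · exact Or.inr ⟨h₁, ih hu h₁' h₂⟩
      · exact Or.inr ⟨h₁, h₂'⟩

theorem subset_closureVia {U : List α} {r : α → α → Bool} {vs : List α} {a b : α}
    (ha : a ∈ U) (hb : b ∈ U) (h : a = b ∨ r a b = true) : (a, b) ∈ closureVia U r vs := by
  induction vs with
  | nil => exact mem_closureVia_nil.2 ⟨ha, hb, h⟩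
  | cons v vs ih => exact mem_closureVia_cons.2 ⟨ha, hb, Or.inl ih⟩

theorem reflTransGen_of_mem_closureVia {U : List α} {r : α → α → Bool} {vs : List α} {a b : α}
    (h : (a, b) ∈ closureVia U r vs) :
    Relation.ReflTransGen (fun x y => y ∈ U ∧ r x y = true) a b := by
  induction vs generalizing a b with
  | nil =>
    obtain ⟨-, hb, rfl | h⟩ := mem_closureVia_nil.1 h
    · exact .refl
    · exact .single ⟨hb, h⟩
  | cons v vs ih =>
    obtain ⟨-, -, h | ⟨h, h'⟩⟩ := mem_closureVia_cons.1 h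
    · exact ih h
    · exact (ih h).trans (ih h')

theorem mem_closureVia_self_iff {U : List α} {r : α → α → Bool} {a b : α} (ha : a ∈ U) :
    (a, b) ∈ closureVia U r U ↔
      Relation.ReflTransGen (fun x y => y ∈ U ∧ r x y = true) a b := by
  refine ⟨reflTransGen_of_mem_closureVia, fun h => ?_⟩
  induction h with
  | refl => exact subset_closureVia ha ha (Or.inl rfl)
  | tail _ h ih =>
    have hc := (mem_of_mem_closureVia ih).2
    exact closureVia_trans hc ih (subset_closureVia hc h.1 (Or.inr h.2))

end Closure

/-! ### The abstract transition system -/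

namespace PTA

/-- The atomic constraints that occur in the automaton or in the list of tokens. -/
def atomList (A : PTA 1) (l : List (Token 1)) : List (Atom 1) :=
  A.inv.flatten ++ (A.trans.flatMap Transition.guard ++ StateFormula.tokenAtoms l)

theorem mem_atomList (A : PTA 1) (φ : StateFormula 1) (a : Atom 1) :
    a ∈ A.atomList φ.tokens ↔ a ∈ A.atoms ∪ φ.atoms := by
  simp only [atomList, List.mem_append, List.mem_flatten, List.mem_flatMap,
    StateFormula.mem_tokenAtoms, atoms, Set.mem_union, Set.mem_ofPred_eq, or_assoc]

/-- The thresholds of the automaton and the state property: `0`, the constants to which the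
clock is reset, and those of the atomic constraints. -/
def thresholds (A : PTA 1) (l : List (Token 1)) : List Threshold :=
  Threshold.const 0 ::
    ((A.trans.flatMap fun t => ((t.upd 0).map Threshold.const).toList) ++
      (A.atomList l).flatMap Atom.thresholds)

theorem const_zero_mem_thresholds (A : PTA 1) (l : List (Token 1)) :
    Threshold.const 0 ∈ A.thresholds l := List.mem_cons_self

theorem const_mem_thresholds {A : PTA 1} {l : List (Token 1)} {t : Transition 1}
    (ht : t ∈ A.trans) {b : ℕ} (hb : t.upd 0 = some b) : Threshold.const b ∈ A.thresholds l := by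
  refine List.mem_cons_of_mem _ (List.mem_append_left _ (List.mem_flatMap.2 ⟨t, ht, ?_⟩))
  simp [hb]

theorem mem_thresholds_of_atom {A : PTA 1} {l : List (Token 1)} {a : Atom 1}
    (ha : a ∈ A.atomList l) {w : Threshold} (hw : w ∈ a.thresholds) : w ∈ A.thresholds l :=
  List.mem_cons_of_mem _ (List.mem_append_right _ (List.mem_flatMap.2 ⟨a, ha, hw⟩))

theorem params_thresholds {A : PTA 1} {φ : StateFormula 1} {w : Threshold}
    (hw : w ∈ A.thresholds φ.tokens) : w.2.params ⊆ A.params φ := by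
  intro i hi
  rcases List.mem_cons.1 hw with rfl | hw
  · simp [Threshold.const, LinForm.params] at hi
  rcases List.mem_append.1 hw with hw | hw
  · obtain ⟨t, -, ht⟩ := List.mem_flatMap.1 hw
    obtain ⟨b, -, rfl⟩ : ∃ b, t.upd 0 = some b ∧ Threshold.const b = w := by simpa using ht
    simp [Threshold.const, LinForm.params] at hi
  · obtain ⟨a, ha, hw⟩ := List.mem_flatMap.1 hw
    refine ⟨a, (mem_atomList A φ a).1 ha, ?_⟩
    rcases a with ⟨l, r, c, _ | e⟩
    · simp [Atom.thresholds] at hw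
    · simp only [Atom.thresholds, List.mem_cons, List.not_mem_nil, or_false] at hw
      rcases hw with rfl | rfl | rfl | rfl <;>
        simpa [LinExpr.params, Threshold.succ, Threshold.neg] using hi

variable (A : PTA 1) (S : List (LinForm × ℤ))

/-- Whether `(q, w)` is an abstract state. -/
def absState (s : ℕ × Threshold) : Bool :=
  -- Thresholds can be negative; only nonnegative ones represent clock values.
  decide (s.1 < A.inv.length) && (Threshold.leIn S (Threshold.const 0) s.2 &&
    (A.invariant s.1).all (Atom.absHolds S s.2))

/-- The clock value after the transition `t`. -/
def absUpdate (t : Transition 1) (w : Threshold) : Threshold :=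
  ((t.upd 0).map Threshold.const).getD w

/-- Whether the transition `t` leads from one abstract state to another. -/
def absFire (t : Transition 1) (s s' : ℕ × Threshold) : Bool :=
  (decide (t.src = s.1) && decide (t.tgt = s'.1)) && (t.guard.all (Atom.absHolds S s.2) &&
    -- Two inequalities instead of a syntactic equality, because different thresholds can have the
    -- same value on the region.
    (Threshold.leIn S (absUpdate t s.2) s'.2 && Threshold.leIn S s'.2 (absUpdate t s.2)))

/-- Whether there is a time advance or a transition from one abstract state to another. -/
def absStep (s s' : ℕ × Threshold) : Bool :=
  (absState A S s && absState A S s') &&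
    ((decide (s'.1 = s.1) && Threshold.leIn S s.2 s'.2) || A.trans.any fun t => absFire S t s s')

/-- All candidates for abstract states. -/
def absUniverse (W : List Threshold) : List (ℕ × Threshold) :=
  (List.range A.inv.length).flatMap fun q => W.map fun w => (q, w)

/-- Whether a state with the property given by the tokens is reachable, according to `S`. -/
def absReach (l : List (Token 1)) : Bool :=
  absState A S (A.init, Threshold.const 0) &&
    (A.absUniverse (A.thresholds l)).any fun s =>
      decide (((A.init, Threshold.const 0), s) ∈ closureVia (A.absUniverse (A.thresholds l))
        (absStep A S) (A.absUniverse (A.thresholds l))) && StateFormula.absHolds S s.1 s.2 l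

/-- The decomposition of the parameter space, with the truth values of the regions. -/
def decomposition (x : PTA 1 × List (Token 1)) : List (LinSystem × Bool) :=
  (LinSystem.signVectors (Threshold.comparisons (x.1.thresholds x.2))).map fun S =>
    ((S, []), absReach x.1 S x.2)

end PTA

/-! ### Floors of clock values -/

/-- `w` is a largest threshold in `W` below the clock value. -/
structure IsFloor (W : List Threshold) (γ : ParamVal) (w : Threshold) (ω : ClockVal 1) :
    Prop where
  mem : w ∈ W
  le : w.eval γ ≤ ω 0
  max : ∀ v ∈ W, v.eval γ ≤ ω 0 → v.eval γ ≤ w.eval γ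

namespace IsFloor

variable {W : List Threshold} {γ : ParamVal} {w w' : Threshold} {ω ω' : ClockVal 1}

theorem le_iff (h : IsFloor W γ w ω) {v : Threshold} (hv : v ∈ W) :
    v.eval γ ≤ w.eval γ ↔ v.eval γ ≤ ω 0 :=
  ⟨fun h' => h'.trans h.le, h.max v hv⟩

theorem mono (h : IsFloor W γ w ω) (h' : IsFloor W γ w' ω') (hω : ω 0 ≤ ω' 0) :
    w.eval γ ≤ w'.eval γ :=
  h'.max w h.mem (h.le.trans (by exact_mod_cast hω))

theorem of_eq (hw : w ∈ W) (h : w.eval γ = ω 0) : IsFloor W γ w ω :=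
  ⟨hw, h.le, fun _ _ hv => hv.trans h.ge⟩

theorem nonneg (h₀ : Threshold.const 0 ∈ W) (h : IsFloor W γ w ω) : 0 ≤ w.eval γ := by
  simpa using h.max _ h₀ (by simp)

theorem exists_floor (h₀ : Threshold.const 0 ∈ W) (γ : ParamVal) (ω : ClockVal 1) :
    ∃ w, IsFloor W γ w ω := by
  classical
  obtain ⟨w, hw, h⟩ := (W.toFinset.filter fun w => w.eval γ ≤ (ω 0 : ℤ)).exists_max_image
    (fun w => w.eval γ) ⟨Threshold.const 0, by simp [h₀]⟩
  simp only [Finset.mem_filter, List.mem_toFinset] at hw h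
  exact ⟨w, hw.1, hw.2, fun v hv hv' => h v ⟨hv, hv'⟩⟩

/-- A reset constant is a threshold, hence its own floor; without a reset nothing changes. -/
theorem absUpdate {A : PTA 1} {l : List (Token 1)} {t : Transition 1} (ht : t ∈ A.trans)
    (h : IsFloor (A.thresholds l) γ w ω) :
    IsFloor (A.thresholds l) γ (PTA.absUpdate t w) (t.upd.apply ω) := by
  rcases hb : t.upd 0 with _ | b
  · have : t.upd.apply ω 0 = ω 0 := by simp [UpdateSet.apply, hb]
    simp only [PTA.absUpdate, hb, Option.map_none, Option.getD_none]
    exact ⟨h.mem, by simpa only [this] using h.le, by simpa only [this] using h.max⟩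
  · refine of_eq ?_ ?_
    · simpa [PTA.absUpdate, hb] using PTA.const_mem_thresholds ht hb
    · simp [PTA.absUpdate, hb, UpdateSet.apply]

end IsFloor

/-! ### Parameter valuations with the same order of the thresholds -/

/-- The two parameter valuations order the thresholds in the same way. -/
def SameOrder (W : List Threshold) (γ γ' : ParamVal) : Prop :=
  ∀ v ∈ W, ∀ w ∈ W, v.eval γ ≤ w.eval γ ↔ v.eval γ' ≤ w.eval γ'

theorem sameOrder_of_sat {W : List Threshold} {S : List (LinForm × ℤ)}
    (hS : S ∈ LinSystem.signVectors (Threshold.comparisons W)) {γ γ' : ParamVal}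
    (hγ : LinSystem.Sat S γ) (hγ' : LinSystem.Sat S γ') : SameOrder W γ γ' := fun _ hv _ hw => by
  rw [← Threshold.leIn_iff hS hγ hv hw, Threshold.leIn_iff hS hγ' hv hw]

/-- The clock value `ω'` is the value under `γ'` of the floor of `ω` under `γ`. -/
def Corresponds (W : List Threshold) (γ γ' : ParamVal) (ω ω' : ClockVal 1) : Prop :=
  ∃ w, IsFloor W γ w ω ∧ w.eval γ' = ω' 0

namespace Corresponds

variable {A : PTA 1} {φ : StateFormula 1} {γ γ' : ParamVal} {ω ω' : ClockVal 1}

local notation "W" => PTA.thresholds A (StateFormula.tokens φ)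

/-- Since `0` is a threshold, the floor is nonnegative under `γ`, and by the common order also under
`γ'`, so its value there is a clock value. -/
theorem exists_right (ho : SameOrder W γ γ') (ω : ClockVal 1) :
    ∃ ω', Corresponds W γ γ' ω ω' := by
  have h₀ := A.const_zero_mem_thresholds φ.tokens
  obtain ⟨w, hw⟩ := IsFloor.exists_floor h₀ γ ω
  have h : 0 ≤ w.eval γ' := by
    simpa using (ho _ h₀ w hw.mem).1 (by simpa using hw.nonneg h₀)
  exact ⟨fun _ => (w.eval γ').toNat, w, hw, (Int.toNat_of_nonneg h).symm⟩

theorem mono (ho : SameOrder W γ γ') {ω₁ ω₂ ω₁' ω₂' : ClockVal 1}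
    (h₁ : Corresponds W γ γ' ω₁ ω₁') (h₂ : Corresponds W γ γ' ω₂ ω₂') (h : ω₁ 0 ≤ ω₂ 0) :
    ω₁' 0 ≤ ω₂' 0 := by
  obtain ⟨w₁, hw₁, e₁⟩ := h₁
  obtain ⟨w₂, hw₂, e₂⟩ := h₂
  have := (ho w₁ hw₁.mem w₂ hw₂.mem).1 (hw₁.mono hw₂ h)
  omega

theorem zero : Corresponds W γ γ' (fun _ => 0) (fun _ => 0) :=
  ⟨Threshold.const 0, .of_eq (A.const_zero_mem_thresholds _) (by simp), by simp⟩

theorem update (h : Corresponds W γ γ' ω ω') {t : Transition 1} (ht : t ∈ A.trans) :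
    Corresponds W γ γ' (t.upd.apply ω) (t.upd.apply ω') := by
  obtain ⟨w, hw, e⟩ := h
  refine ⟨PTA.absUpdate t w, hw.absUpdate ht, ?_⟩
  rcases hb : t.upd 0 with _ | b <;> simp [PTA.absUpdate, UpdateSet.apply, hb, e]

theorem le_iff (ho : SameOrder W γ γ') (h : Corresponds W γ γ' ω ω') {v : Threshold}
    (hv : v ∈ W) : v.eval γ ≤ ω 0 ↔ v.eval γ' ≤ ω' 0 := by
  obtain ⟨w, hw, e⟩ := h
  rw [← hw.le_iff hv, ho v hv w hw.mem, e]

theorem atom_iff (ho : SameOrder W γ γ') (h : Corresponds W γ γ' ω ω') {a : Atom 1}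
    (ha : a ∈ A.atoms ∪ φ.atoms) : a.Holds γ ω ↔ a.Holds γ' ω' := by
  have hW : ∀ w ∈ a.thresholds, w ∈ W := fun w hw =>
    PTA.mem_thresholds_of_atom ((PTA.mem_atomList A φ a).2 ha) hw
  rw [a.holds_iff_test, a.holds_iff_test, Atom.test_congr]
  · exact fun w hw => by simpa using h.le_iff ho (hW w hw)
  -- Comparisons with `0` are comparisons with the clock value `0`, which corresponds to itself.
  · exact fun w hw => by simpa using zero.le_iff ho (hW w hw)

theorem formula_iff (ho : SameOrder W γ γ') (h : Corresponds W γ γ' ω ω') (q : ℕ) :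
    φ.Holds γ q ω ↔ φ.Holds γ' q ω' := by
  -- The induction runs over `ψ` while the thresholds remain those of `φ`.
  have : ∀ ψ : StateFormula 1, ψ.atoms ⊆ φ.atoms → (ψ.Holds γ q ω ↔ ψ.Holds γ' q ω') := by
    intro ψ hψ
    induction ψ with
    | atom a => exact h.atom_iff ho (Or.inr (hψ rfl))
    | loc q' => exact Iff.rfl
    | neg ψ ih => exact not_congr (ih hψ)
    | and ψ₁ ψ₂ ih₁ ih₂ =>
      exact and_congr (ih₁ (Set.subset_union_left.trans hψ))
        (ih₂ (Set.subset_union_right.trans hψ))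
    | or ψ₁ ψ₂ ih₁ ih₂ =>
      exact or_congr (ih₁ (Set.subset_union_left.trans hψ))
        (ih₂ (Set.subset_union_right.trans hψ))
  exact this φ subset_rfl

theorem runFormula_iff (ho : SameOrder W γ γ') (h : Corresponds W γ γ' ω ω')
    {χ : ParamVal → ClockVal 1 → Prop} (hχ : A.IsRunFormula φ χ) : χ γ ω ↔ χ γ' ω' := by
  induction hχ with
  | atom a ha => exact h.atom_iff ho ha
  | reset a ha t ht => exact (h.update ht).atom_iff ho ha
  | neg χ _ ih => exact not_congr ih
  | and χ₁ χ₂ _ _ ih₁ ih₂ => exact and_congr ih₁ ih₂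
  | or χ₁ χ₂ _ _ ih₁ ih₂ => exact or_congr ih₁ ih₂

end Corresponds

/-! ### Transfer of states, runs and formulas within a region -/

namespace PTA

theorem mem_atoms_of_invariant {A : PTA 1} {q : ℕ} {a : Atom 1} (h : a ∈ A.invariant q) :
    a ∈ A.atoms := by
  rw [invariant, List.getD_eq_getElem?_getD] at h
  rcases hq : A.inv[q]? with _ | g
  · simp [hq] at h
  · exact Or.inl ⟨g, List.mem_of_getElem? hq, by simpa [hq] using h⟩

theorem mem_atoms_of_guard {A : PTA 1} {t : Transition 1} (ht : t ∈ A.trans) {a : Atom 1}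
    (h : a ∈ t.guard) : a ∈ A.atoms := Or.inr ⟨t, ht, h⟩

section Transfer

variable {A : PTA 1} {φ : StateFormula 1} {γ γ' : ParamVal} {ω ω' ω₁ ω₁' : ClockVal 1} {q q₁ : ℕ}

local notation "W" => PTA.thresholds A (StateFormula.tokens φ)

theorem isState_transfer (ho : SameOrder W γ γ') (h : Corresponds W γ γ' ω ω')
    (hs : A.IsState γ (q, ω)) : A.IsState γ' (q, ω') :=
  ⟨hs.1, fun a ha => (h.atom_iff ho (Or.inl (mem_atoms_of_invariant ha))).1 (hs.2 a ha)⟩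

theorem delay_transfer (ho : SameOrder W γ γ') (h : Corresponds W γ γ' ω ω')
    (h₁ : Corresponds W γ γ' ω₁ ω₁') {d : ℕ} (hd : A.Delay γ d (q, ω) (q₁, ω₁)) :
    ∃ d', A.Delay γ' d' (q, ω') (q₁, ω₁') := by
  obtain ⟨hs, hs₁, e, rfl⟩ := hd
  have hle := h.mono ho h₁ (Nat.le_add_right _ _)
  -- The duration may change; by `hle` the subtraction is not truncated.
  refine ⟨ω₁' 0 - ω' 0, isState_transfer ho h hs, isState_transfer ho h₁ hs₁, e, ?_⟩
  funext i
  rw [Fin.fin_one_eq_zero i]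
  dsimp only
  omega

theorem fire_transfer (ho : SameOrder W γ γ') (h : Corresponds W γ γ' ω ω') {t : Transition 1}
    (hf : A.Fire γ t (q, ω) (q₁, ω₁)) :
    Corresponds W γ γ' ω₁ (t.upd.apply ω') ∧ A.Fire γ' t (q, ω') (q₁, t.upd.apply ω') := by
  obtain ⟨hs, hs₁, ht, e, e₁, hg, rfl⟩ := hf
  have h₁ := h.update ht
  exact ⟨h₁, isState_transfer ho h hs, isState_transfer ho h₁ hs₁, ht, e, e₁,
    fun a ha => (h.atom_iff ho (Or.inl (mem_atoms_of_guard ht ha))).1 (hg a ha), rfl⟩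

theorem runAlong_transfer (ho : SameOrder W γ γ') {τ : List (Transition 1)}
    (h : Corresponds W γ γ' ω ω') (hr : A.RunAlong γ (q, ω) τ (q₁, ω₁)) :
    ∃ ω₁', Corresponds W γ γ' ω₁ ω₁' ∧ A.RunAlong γ' (q, ω') τ (q₁, ω₁') := by
  induction τ generalizing q ω ω' with
  | nil =>
    obtain ⟨rfl, rfl⟩ := Prod.mk.inj hr
    exact ⟨ω', h, rfl⟩
  | cons t τ ih =>
    obtain ⟨d, ⟨q₂, ω₂⟩, ⟨q₃, ω₃⟩, hd, hf, hr⟩ := hr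
    obtain ⟨ω₂', h₂⟩ := Corresponds.exists_right ho ω₂
    obtain ⟨d', hd'⟩ := delay_transfer ho h h₂ hd
    obtain ⟨h₃, hf'⟩ := fire_transfer ho h₂ hf
    obtain ⟨ω₁', h₁, hr'⟩ := ih h₃ hr
    exact ⟨ω₁', h₁, d', _, _, hd', hf', hr'⟩

theorem runStates_transfer (ho : SameOrder W γ γ') {τ : List (Transition 1)}
    (h : (q, ω) ∈ A.runStates τ γ) :
    ∃ ω', Corresponds W γ γ' ω ω' ∧ (q, ω') ∈ A.runStates τ γ' := by
  obtain ⟨s₀, ⟨hs, rfl⟩, hr⟩ := h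
  obtain ⟨ω', h', hr'⟩ := runAlong_transfer ho .zero hr
  exact ⟨ω', h', _, ⟨isState_transfer ho .zero hs, rfl⟩, hr'⟩

theorem runStates_nonempty_transfer (ho : SameOrder W γ γ') {τ : List (Transition 1)}
    (h : (A.runStates τ γ).Nonempty) : (A.runStates τ γ').Nonempty := by
  obtain ⟨⟨q, ω⟩, h⟩ := h
  obtain ⟨ω', -, h'⟩ := runStates_transfer ho h
  exact ⟨_, h'⟩

theorem runSat_transfer (ho : SameOrder W γ γ') {τ : List (Transition 1)}
    (h : A.RunSat τ γ φ) : A.RunSat τ γ' φ := by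
  obtain ⟨⟨q, ω⟩, h, hφ⟩ := h
  obtain ⟨ω', hc, h'⟩ := runStates_transfer ho h
  exact ⟨_, h', (hc.formula_iff ho q).1 hφ⟩

theorem exists_runFormula_transfer (ho : SameOrder W γ γ') {χ : ParamVal → ClockVal 1 → Prop}
    (hχ : A.IsRunFormula φ χ) (h : ∃ ω, χ γ ω) : ∃ ω, χ γ' ω := by
  obtain ⟨ω, h⟩ := h
  obtain ⟨ω', hc⟩ := Corresponds.exists_right ho ω
  exact ⟨ω', (hc.runFormula_iff ho hχ).1 h⟩

end Transfer

/-! ### The abstract system describes the reachable states -/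

section Abstraction

variable {A : PTA 1} {φ : StateFormula 1} {γ : ParamVal} {ω ω' : ClockVal 1} {q q' : ℕ}
  {w w' : Threshold} {S : List (LinForm × ℤ)}

local notation "W" => PTA.thresholds A (StateFormula.tokens φ)

theorem absHolds_iff (hS : S ∈ LinSystem.signVectors (Threshold.comparisons W))
    (hγ : LinSystem.Sat S γ) (h : IsFloor W γ w ω) {a : Atom 1} (ha : a ∈ A.atoms ∪ φ.atoms) :
    a.absHolds S w = true ↔ a.Holds γ ω := by
  have hW : ∀ v ∈ a.thresholds, v ∈ W := fun v hv =>
    mem_thresholds_of_atom ((mem_atomList A φ a).2 ha) hv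
  rw [a.holds_iff_test, Atom.absHolds, Atom.test_congr]
  · intro v hv
    rw [Bool.eq_iff_iff, decide_eq_true_iff, Threshold.leIn_iff hS hγ (hW v hv) h.mem,
      h.le_iff (hW v hv)]
  · intro v hv
    rw [Bool.eq_iff_iff, decide_eq_true_iff,
      Threshold.leIn_iff hS hγ (hW v hv) (A.const_zero_mem_thresholds _)]
    simp

theorem absState_iff (hS : S ∈ LinSystem.signVectors (Threshold.comparisons W))
    (hγ : LinSystem.Sat S γ) (h : IsFloor W γ w ω) :
    A.absState S (q, w) = true ↔ A.IsState γ (q, ω) := by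
  have h₀ := A.const_zero_mem_thresholds φ.tokens
  have h₁ : Threshold.leIn S (Threshold.const 0) w = true :=
    (Threshold.leIn_iff hS hγ h₀ h.mem).2 (by simpa using h.nonneg h₀)
  simp only [absState, h₁, Bool.true_and, Bool.and_eq_true, decide_eq_true_iff, List.all_eq_true]
  exact and_congr Iff.rfl (forall₂_congr fun a ha =>
    absHolds_iff hS hγ h (Or.inl (mem_atoms_of_invariant ha)))

/-- Any choice of floors works: two floors of one clock value have equal values, and floors are
monotone in the clock value. -/
theorem absStep_of_step (hS : S ∈ LinSystem.signVectors (Threshold.comparisons W))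
    (hγ : LinSystem.Sat S γ) (h : IsFloor W γ w ω) (h' : IsFloor W γ w' ω') {δ : ℕ ⊕ ℕ}
    (hs : (A.lts γ).step (q, ω) δ (q', ω')) : A.absStep S (q, w) (q', w') = true := by
  rw [absStep, Bool.and_eq_true, Bool.and_eq_true, Bool.or_eq_true, List.any_eq_true]
  rcases δ with a | d
  · obtain ⟨t, -, hs, hs', ht, e, e', hg, rfl⟩ := hs
    refine ⟨⟨(absState_iff hS hγ h).2 hs, (absState_iff hS hγ h').2 hs'⟩, Or.inr ⟨t, ht, ?_⟩⟩
    have hu := h.absUpdate ht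
    simp only [absFire, Bool.and_eq_true, decide_eq_true_iff, List.all_eq_true]
    exact ⟨⟨e, e'⟩, fun a ha => (absHolds_iff hS hγ h (Or.inl (mem_atoms_of_guard ht ha))).2
      (hg a ha), (Threshold.leIn_iff hS hγ hu.mem h'.mem).2 (hu.mono h' le_rfl),
      (Threshold.leIn_iff hS hγ h'.mem hu.mem).2 (h'.mono hu le_rfl)⟩
  · obtain ⟨hs, hs', e, rfl⟩ := hs
    refine ⟨⟨(absState_iff hS hγ h).2 hs, (absState_iff hS hγ h').2 hs'⟩, Or.inl ?_⟩
    rw [Bool.and_eq_true, decide_eq_true_iff, Threshold.leIn_iff hS hγ h.mem h'.mem]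
    exact ⟨e, h.mono h' (Nat.le_add_right _ _)⟩

/-- Here the clock values are exactly the threshold values, so each is its own floor and the
abstract tests are the concrete conditions. -/
theorem step_of_absStep (hS : S ∈ LinSystem.signVectors (Threshold.comparisons W))
    (hγ : LinSystem.Sat S γ) (hw : w ∈ W) (hw' : w' ∈ W) (e : w.eval γ = ω 0)
    (e' : w'.eval γ = ω' 0) (h : A.absStep S (q, w) (q', w') = true) :
    ∃ δ, (A.lts γ).step (q, ω) δ (q', ω') := by
  have hf := IsFloor.of_eq hw e
  have hf' := IsFloor.of_eq hw' e'
  rw [absStep, Bool.and_eq_true, Bool.and_eq_true, Bool.or_eq_true, List.any_eq_true,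
    absState_iff hS hγ hf, absState_iff hS hγ hf', Bool.and_eq_true, decide_eq_true_iff,
    Threshold.leIn_iff hS hγ hw hw', e, e'] at h
  obtain ⟨⟨hs, hs'⟩, ⟨hq, hle⟩ | ⟨t, ht, h⟩⟩ := h
  · refine ⟨Sum.inr (ω' 0 - ω 0), hs, hs', hq, ?_⟩
    funext i
    rw [Fin.fin_one_eq_zero i]
    dsimp only at hle ⊢
    omega
  · have hu := hf.absUpdate ht
    simp only [absFire, Bool.and_eq_true, decide_eq_true_iff, List.all_eq_true] at h
    rw [Threshold.leIn_iff hS hγ hu.mem hw', Threshold.leIn_iff hS hγ hw' hu.mem] at h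
    obtain ⟨⟨h₁, h₂⟩, hg, h₃, h₄⟩ := h
    refine ⟨Sum.inl t.act, t, rfl, hs, hs', ht, h₁, h₂, fun a ha =>
      (absHolds_iff hS hγ hf (Or.inl (mem_atoms_of_guard ht ha))).1 (hg a ha), ?_⟩
    funext i
    rw [Fin.fin_one_eq_zero i]
    rcases hb : t.upd 0 with _ | b
    · simp only [absUpdate, hb, Option.map_none, Option.getD_none] at h₃ h₄
      simp only [UpdateSet.apply, hb, Option.getD_none]
      omega
    · simp only [absUpdate, hb, Option.map_some, Option.getD_some, Threshold.eval_const] at h₃ h₄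
      simp only [UpdateSet.apply, hb, Option.getD_some]
      omega

theorem mem_absUniverse {U : List Threshold} :
    (q, w) ∈ A.absUniverse U ↔ q < A.inv.length ∧ w ∈ U := by
  simp [absUniverse]

theorem exists_reachable_of_absReachable
    (hS : S ∈ LinSystem.signVectors (Threshold.comparisons W)) (hγ : LinSystem.Sat S γ)
    (hi : A.absState S (A.init, Threshold.const 0) = true) {s : ℕ × Threshold}
    (h : Relation.ReflTransGen (fun x y => y ∈ A.absUniverse W ∧ A.absStep S x y = true)
      (A.init, Threshold.const 0) s) :
    s.2 ∈ W ∧ ∃ ω : ClockVal 1, s.2.eval γ = ω 0 ∧ (A.lts γ).Reachable (s.1, ω) := by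
  have h₀ := A.const_zero_mem_thresholds φ.tokens
  induction h with
  | refl =>
    refine ⟨h₀, fun _ => 0, by simp, _, ⟨?_, rfl⟩, .refl⟩
    exact (absState_iff hS hγ (IsFloor.of_eq h₀ (by simp))).1 hi
  | @tail s s' _ h ih =>
    obtain ⟨hw, ω, e, s₀, hs₀, hr⟩ := ih
    obtain ⟨hu, hs⟩ := h
    have hw' := (mem_absUniverse.1 hu).2
    have hs' := hs
    rw [absStep, Bool.and_eq_true, Bool.and_eq_true] at hs'
    have hn := hs'.1.2
    rw [absState, Bool.and_eq_true, Bool.and_eq_true, Threshold.leIn_iff hS hγ h₀ hw',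
      Threshold.eval_const] at hn
    -- Nonnegativity comes from the test `0 ≤ w` in `absState`.
    have e' : s'.2.eval γ = ((s'.2.eval γ).toNat : ℤ) := (Int.toNat_of_nonneg hn.2.1).symm
    exact ⟨hw', fun _ => (s'.2.eval γ).toNat, e', s₀, hs₀,
      hr.tail (step_of_absStep hS hγ hw hw' e e' hs)⟩

theorem isState_of_step {δ : ℕ ⊕ ℕ} {s s' : ℕ × ClockVal 1} (h : (A.lts γ).step s δ s') :
    A.IsState γ s' := by
  rcases δ with a | d
  · obtain ⟨t, -, h⟩ := h
    exact h.2.1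
  · exact h.2.1

theorem exists_absReachable_of_reachable
    (hS : S ∈ LinSystem.signVectors (Threshold.comparisons W)) (hγ : LinSystem.Sat S γ)
    {s : ℕ × ClockVal 1} (h : (A.lts γ).Reachable s) :
    A.absState S (A.init, Threshold.const 0) = true ∧ ∃ w, IsFloor W γ w s.2 ∧
      (s.1, w) ∈ A.absUniverse W ∧
      Relation.ReflTransGen (fun x y => y ∈ A.absUniverse W ∧ A.absStep S x y = true)
        (A.init, Threshold.const 0) (s.1, w) := by
  have h₀ := A.const_zero_mem_thresholds φ.tokens
  obtain ⟨s₀, ⟨hs, rfl⟩, hr⟩ := h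
  have hf : IsFloor W γ (Threshold.const 0) (fun _ => 0) := .of_eq h₀ (by simp)
  refine ⟨(absState_iff hS hγ hf).2 hs, ?_⟩
  induction hr with
  | refl => exact ⟨_, hf, mem_absUniverse.2 ⟨hs.1, h₀⟩, .refl⟩
  | @tail s s' _ h ih =>
    obtain ⟨w, hw, -, hr⟩ := ih
    obtain ⟨δ, h⟩ := h
    obtain ⟨w', hw'⟩ := IsFloor.exists_floor h₀ γ s'.2
    have hu : (s'.1, w') ∈ A.absUniverse W :=
      mem_absUniverse.2 ⟨(isState_of_step h).1, hw'.mem⟩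
    exact ⟨w', hw', hu, hr.tail ⟨hu, absStep_of_step hS hγ hw hw' h⟩⟩

theorem absReach_iff (hS : S ∈ LinSystem.signVectors (Threshold.comparisons W))
    (hγ : LinSystem.Sat S γ) (hA : A.init < A.inv.length) :
    A.absReach S φ.tokens = true ↔ A.SatExistsEventually γ φ := by
  -- The closure is reflexive only on the universe, so the starting vertex must belong to it.
  have hi : (A.init, Threshold.const 0) ∈ A.absUniverse W :=
    mem_absUniverse.2 ⟨hA, A.const_zero_mem_thresholds _⟩
  have hφ : ∀ {q : ℕ} {w : Threshold} {ω : ClockVal 1}, IsFloor W γ w ω →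
      (StateFormula.absHolds S q w φ.tokens = true ↔ φ.Holds γ q ω) := fun hw =>
    StateFormula.absHolds_iff φ fun a ha => absHolds_iff hS hγ hw (Or.inr ha)
  simp only [absReach, Bool.and_eq_true, List.any_eq_true, decide_eq_true_iff,
    mem_closureVia_self_iff hi]
  constructor
  · rintro ⟨hs, s, -, hr, h⟩
    obtain ⟨hw, ω, e, hr⟩ := exists_reachable_of_absReachable hS hγ hs hr
    exact ⟨_, hr, (hφ (.of_eq hw e)).1 h⟩
  · rintro ⟨s, hr, h⟩
    obtain ⟨hs, w, hw, hu, hr⟩ := exists_absReachable_of_reachable hS hγ hr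
    exact ⟨hs, _, hu, hr, (hφ hw).2 h⟩

end Abstraction

end PTA

/-! ### Primitive recursive functions on integers, lists and syntax -/

namespace Primrec

/-- The code of `n` is `2 * n` and that of `-(n + 1)` is `2 * n + 1`; integer arithmetic is reduced
to natural numbers through `z = z.toNat - (-z).toNat`. -/
theorem int_ofNat : Primrec (Int.ofNat : ℕ → ℤ) :=
  Primrec.encode_iff.1 (nat_double.of_eq fun _ => rfl)

theorem int_negSucc : Primrec Int.negSucc :=
  Primrec.encode_iff.1 (nat_double_succ.of_eq fun _ => rfl)

theorem int_subNatNat : Primrec₂ Int.subNatNat := by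
  have h : Primrec fun p : ℕ × ℕ => if p.2 ≤ p.1 then Int.ofNat (p.1 - p.2)
      else Int.negSucc (p.2 - p.1 - 1) :=
    .ite (nat_le.comp snd fst) (int_ofNat.comp (nat_sub.comp fst snd))
      (int_negSucc.comp (nat_sub.comp (nat_sub.comp snd fst) (const 1)))
  refine h.of_eq fun p => ?_
  rw [Int.subNatNat_eq_coe]
  split_ifs with h
  · simp only [Int.ofNat_eq_natCast]
    omega
  · omega

theorem int_toNat : Primrec Int.toNat := by
  have h : Primrec fun z : ℤ => bif Nat.bodd (Encodable.encode z) then 0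
      else Nat.div2 (Encodable.encode z) :=
    .cond (nat_bodd.comp .encode) (const 0) (nat_div2.comp .encode)
  refine h.of_eq fun z => ?_
  rcases z with n | n
  · have : Encodable.encode (n : ℤ) = 2 * n := rfl
    simp [this]
  · have : Encodable.encode (Int.negSucc n) = 2 * n + 1 := rfl
    simp [this]

theorem int_negToNat : Primrec fun z : ℤ => (-z).toNat := by
  have h : Primrec fun z : ℤ => bif Nat.bodd (Encodable.encode z) then
      Nat.div2 (Encodable.encode z) + 1 else 0 :=
    .cond (nat_bodd.comp .encode) (succ.comp (nat_div2.comp .encode)) (const 0)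
  refine h.of_eq fun z => ?_
  rcases z with n | n
  · have : Encodable.encode (n : ℤ) = 2 * n := rfl
    simp [this]
  · have : Encodable.encode (Int.negSucc n) = 2 * n + 1 := rfl
    simp [this]

theorem int_neg : Primrec (Neg.neg : ℤ → ℤ) :=
  (int_subNatNat.comp int_negToNat int_toNat).of_eq fun z => by
    rw [Int.subNatNat_eq_coe]
    omega

theorem int_add : Primrec₂ ((· + ·) : ℤ → ℤ → ℤ) :=
  (int_subNatNat.comp
    (nat_add.comp (int_toNat.comp fst) (int_toNat.comp snd))
    (nat_add.comp (int_negToNat.comp fst) (int_negToNat.comp snd))).of_eq fun p => by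
    dsimp only
    rw [Int.subNatNat_eq_coe]
    omega

variable {α β σ : Type} [Primcodable α] [Primcodable β] [Primcodable σ]

theorem list_any {f : α → List β} {p : α → β → Bool} (hf : Primrec f) (hp : Primrec₂ p) :
    Primrec fun a => (f a).any (p a) := by
  have h : Primrec fun a => (f a).foldr (fun b r => p a b || r) false :=
    list_foldr hf (const false)
      (Primrec.or.comp (hp.comp fst (fst.comp snd)) (snd.comp snd)).to₂
  exact h.of_eq fun a => by induction f a <;> simp_all

theorem list_all {f : α → List β} {p : α → β → Bool} (hf : Primrec f) (hp : Primrec₂ p) :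
    Primrec fun a => (f a).all (p a) := by
  have h : Primrec fun a => (f a).foldr (fun b r => p a b && r) true :=
    list_foldr hf (const true)
      (Primrec.and.comp (hp.comp fst (fst.comp snd)) (snd.comp snd)).to₂
  exact h.of_eq fun a => by induction f a <;> simp_all

theorem decide_eq [DecidableEq β] {f g : α → β} (hf : Primrec f) (hg : Primrec g) :
    Primrec fun a => decide (f a = g a) :=
  (Primrec.eq.comp hf hg).decide

theorem decide_mem {f : α → β} {l : α → List β} [∀ a, Decidable (f a ∈ l a)] (hf : Primrec f)
    (hl : Primrec l) : Primrec fun a => decide (f a ∈ l a) := by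
  classical
  exact (list_any hl (decide_eq (hf.comp fst) snd).to₂).of_eq fun a => by
    rw [Bool.eq_iff_iff, List.any_eq_true]
    simp

theorem atom_equivProd {n : ℕ} : Primrec (Atom.equivProd : Atom n ≃ _) := of_equiv

theorem atom_left {n : ℕ} : Primrec (Atom.left : Atom n → _) := fst.comp atom_equivProd

theorem atom_right {n : ℕ} : Primrec (Atom.right : Atom n → _) :=
  (fst.comp snd).comp atom_equivProd

theorem atom_rel {n : ℕ} : Primrec (Atom.rel : Atom n → _) :=
  (fst.comp (snd.comp snd)).comp atom_equivProd

theorem atom_expr {n : ℕ} : Primrec (Atom.expr : Atom n → _) :=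
  (snd.comp (snd.comp snd)).comp atom_equivProd

theorem transition_equivProd {n : ℕ} : Primrec (Transition.equivProd : Transition n ≃ _) :=
  of_equiv

theorem transition_src {n : ℕ} : Primrec (Transition.src : Transition n → _) :=
  fst.comp transition_equivProd

theorem transition_guard {n : ℕ} : Primrec (Transition.guard : Transition n → _) :=
  (fst.comp snd).comp transition_equivProd

theorem transition_upd {n : ℕ} : Primrec (Transition.upd : Transition n → _) :=
  (fst.comp (snd.comp (snd.comp snd))).comp transition_equivProd

theorem transition_tgt {n : ℕ} : Primrec (Transition.tgt : Transition n → _) :=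
  (snd.comp (snd.comp (snd.comp snd))).comp transition_equivProd

theorem transition_upd_zero : Primrec fun t : Transition 1 => t.upd 0 :=
  fin_app.comp transition_upd (const 0)

theorem pta_equivProd {n : ℕ} : Primrec (PTA.equivProd : PTA n ≃ _) := of_equiv

theorem pta_init {n : ℕ} : Primrec (PTA.init : PTA n → _) := (fst.comp snd).comp pta_equivProd

theorem pta_inv {n : ℕ} : Primrec (PTA.inv : PTA n → _) :=
  (fst.comp (snd.comp snd)).comp pta_equivProd

theorem pta_trans {n : ℕ} : Primrec (PTA.trans : PTA n → _) :=
  (snd.comp (snd.comp snd)).comp pta_equivProd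

theorem pta_invariant {n : ℕ} : Primrec₂ (PTA.invariant : PTA n → ℕ → _) :=
  (list_getD []).comp (pta_inv.comp fst) snd

/-! ### The decomposition is primitive recursive -/

theorem linForm_neg : Primrec LinForm.neg :=
  list_map .id ((int_neg.comp (fst.comp snd)).pair (snd.comp snd)).to₂

theorem threshold_const : Primrec Threshold.const := int_ofNat.pair (const [])

theorem threshold_neg : Primrec Threshold.neg := (int_neg.comp fst).pair (linForm_neg.comp snd)

theorem threshold_succ : Primrec Threshold.succ := (int_add.comp fst (const 1)).pair snd

theorem threshold_ineq : Primrec₂ Threshold.ineq :=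
  (list_append.comp (snd.comp snd) (linForm_neg.comp (snd.comp fst))).pair
    (int_add.comp (fst.comp fst) (int_neg.comp (fst.comp snd)))

theorem negIneq : Primrec LinSystem.negIneq :=
  (linForm_neg.comp fst).pair (int_add.comp (const 1) (int_neg.comp snd))

theorem signVectors : Primrec LinSystem.signVectors :=
  list_foldr .id (const [[]]) (list_append.comp
    (list_map (snd.comp snd) (list_cons.comp (fst.comp (snd.comp fst)) snd).to₂)
    (list_map (snd.comp snd)
      (list_cons.comp (negIneq.comp (fst.comp (snd.comp fst))) snd).to₂)).to₂

theorem comparisons : Primrec Threshold.comparisons :=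
  list_flatMap .id (list_map fst (threshold_ineq.comp (snd.comp fst) snd).to₂).to₂

theorem threshold_leIn {S : α → List (LinForm × ℤ)} {w w' : α → Threshold} (hS : Primrec S)
    (hw : Primrec w) (hw' : Primrec w') : Primrec fun a => Threshold.leIn (S a) (w a) (w' a) :=
  list_any hS (decide_eq snd (threshold_ineq.comp (hw.comp fst) (hw'.comp fst))).to₂

theorem atom_thresholds : Primrec (Atom.thresholds : Atom 1 → List Threshold) := by
  have h : Primrec fun a : Atom 1 => (Option.casesOn a.expr [] fun e =>
      [e, Threshold.succ e, Threshold.neg e, Threshold.succ (Threshold.neg e)] :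
        List Threshold) :=
    option_casesOn atom_expr (const []) (list_cons.comp snd (list_cons.comp
      (threshold_succ.comp snd) (list_cons.comp (threshold_neg.comp snd) (list_cons.comp
        (threshold_succ.comp (threshold_neg.comp snd)) (const []))))).to₂
  refine h.of_eq fun a => ?_
  rcases a with ⟨l, r, c, _ | e⟩ <;> rfl

instance : Finite CmpRel := Finite.of_equiv _ CmpRel.equivFin.symm

/-- Every function on a finite type is primitive recursive; for this reason `Atom.combine` takes
truth values instead of thresholds. -/
theorem atom_combine : Primrec fun x : (Option (Fin 1) × Option (Fin 1) × CmpRel) ×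
    (Bool × Bool × Bool × Bool × Bool × Bool) =>
    Atom.combine x.1.1 x.1.2.1 x.1.2.2 x.2.1 x.2.2.1 x.2.2.2.1 x.2.2.2.2.1 x.2.2.2.2.2.1
      x.2.2.2.2.2.2 :=
  dom_finite _

theorem atom_absHolds {S : α → List (LinForm × ℤ)} {w : α → Threshold} {x : α → Atom 1}
    (hS : Primrec S) (hw : Primrec w) (hx : Primrec x) :
    Primrec fun a => (x a).absHolds (S a) (w a) := by
  have hS' : Primrec fun p : α × Threshold => S p.1 := hS.comp fst
  have hw' : Primrec fun p : α × Threshold => w p.1 := hw.comp fst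
  have hx' : Primrec fun p : α × Threshold => x p.1 := hx.comp fst
  have h0 : Primrec fun _ : α × Threshold => Threshold.const 0 := const _
  have h1 : Primrec fun p : α × Threshold => Threshold.succ p.2 := threshold_succ.comp snd
  have h2 : Primrec fun p : α × Threshold => Threshold.neg p.2 := threshold_neg.comp snd
  have h3 : Primrec fun p : α × Threshold => Threshold.succ (Threshold.neg p.2) :=
    threshold_succ.comp h2
  have h := option_casesOn (atom_expr.comp hx) ((dom_finite CmpRel.finite).comp (atom_rel.comp hx))
    (atom_combine.comp (((atom_left.comp hx').pair ((atom_right.comp hx').pair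
        (atom_rel.comp hx'))).pair
      ((threshold_leIn hS' snd hw').pair ((threshold_leIn hS' h1 hw').pair
        ((threshold_leIn hS' h2 hw').pair ((threshold_leIn hS' h3 hw').pair
          ((threshold_leIn hS' snd h0).pair (threshold_leIn hS' h1 h0)))))))).to₂
  refine h.of_eq fun a => ?_
  dsimp only
  rcases x a with ⟨l, r, c, _ | e⟩ <;> rfl

theorem constraint_absHolds {S : α → List (LinForm × ℤ)} {w : α → Threshold}
    {g : α → Constraint 1} (hS : Primrec S) (hw : Primrec w) (hg : Primrec g) :
    Primrec fun a => (g a).all (Atom.absHolds (S a) (w a)) :=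
  list_all hg (atom_absHolds (hS.comp fst) (hw.comp fst) snd).to₂

theorem stackStep {S : α → List (LinForm × ℤ)} {q : α → ℕ} {w : α → Threshold}
    {k : α → Token 1} {st : α → List Bool} (hS : Primrec S) (hq : Primrec q) (hw : Primrec w)
    (hk : Primrec k) (hst : Primrec st) :
    Primrec fun a => StateFormula.stackStep (S a) (q a) (w a) (k a) (st a) := by
  have hst' : Primrec fun p : (α × (ℕ ⊕ Fin 3)) × Fin 3 => st p.1.1 := hst.comp (fst.comp fst)
  have h₁ := list_headI.comp hst'
  have ht := list_tail.comp hst'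
  have h₂ := list_headI.comp ht
  have htt := list_tail.comp ht
  have hc : Primrec fun p : (α × (ℕ ⊕ Fin 3)) × Fin 3 =>
      if p.2 = 0 then (!(st p.1.1).headI) :: (st p.1.1).tail
      else if p.2 = 1 then ((st p.1.1).headI && (st p.1.1).tail.headI) :: (st p.1.1).tail.tail
      else ((st p.1.1).headI || (st p.1.1).tail.headI) :: (st p.1.1).tail.tail :=
    .ite (Primrec.eq.comp snd (const 0)) (list_cons.comp (Primrec.not.comp h₁) ht)
      (.ite (Primrec.eq.comp snd (const 1)) (list_cons.comp (Primrec.and.comp h₁ h₂) htt)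
        (list_cons.comp (Primrec.or.comp h₁ h₂) htt))
  have hl : Primrec fun p : (α × (ℕ ⊕ Fin 3)) × ℕ => decide (q p.1.1 = p.2) :: st p.1.1 :=
    list_cons.comp (decide_eq (hq.comp (fst.comp fst)) snd) (hst.comp (fst.comp fst))
  have ha : Primrec fun p : α × Atom 1 => p.2.absHolds (S p.1) (w p.1) :: st p.1 :=
    list_cons.comp (atom_absHolds (hS.comp fst) (hw.comp fst) snd) (hst.comp fst)
  exact sumCasesOn hk ha.to₂ (sumCasesOn snd hl.to₂ hc.to₂).to₂

theorem stateFormula_absHolds {S : α → List (LinForm × ℤ)} {q : α → ℕ} {w : α → Threshold}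
    {l : α → List (Token 1)} (hS : Primrec S) (hq : Primrec q) (hw : Primrec w)
    (hl : Primrec l) : Primrec fun a => StateFormula.absHolds (S a) (q a) (w a) (l a) :=
  list_headI.comp (list_foldr hl (const []) (stackStep (hS.comp fst) (hq.comp fst) (hw.comp fst)
    (fst.comp snd) (snd.comp snd)).to₂)

theorem tokenAtoms : Primrec StateFormula.tokenAtoms :=
  list_flatMap .id (sumCasesOn snd (list_cons.comp snd (const [])).to₂ (const []).to₂).to₂

theorem pta_thresholds : Primrec₂ PTA.thresholds := by
  have hA : Primrec₂ PTA.atomList :=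
    list_append.comp (list_flatten.comp (pta_inv.comp fst)) (list_append.comp
      (list_flatMap (pta_trans.comp fst) (transition_guard.comp snd).to₂)
      (tokenAtoms.comp snd))
  exact list_cons.comp (const _) (list_append.comp
    (list_flatMap (pta_trans.comp fst) (optionToList.comp
      (option_map (transition_upd_zero.comp snd) (threshold_const.comp snd).to₂)).to₂)
    (list_flatMap hA (atom_thresholds.comp snd).to₂))

theorem pairsOf {U : α → List β} {r : α → β → β → Bool} (hU : Primrec U)
    (hr : Primrec fun x : α × β × β => r x.1 x.2.1 x.2.2) :
    Primrec fun a => _root_.pairsOf (U a) (r a) := by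
  have h : Primrec fun p : (α × β) × β =>
      bif r p.1.1 p.1.2 p.2 then [(p.1.2, p.2)] else [] :=
    .cond (hr.comp ((fst.comp fst).pair ((snd.comp fst).pair snd)))
      (list_cons.comp ((snd.comp fst).pair snd) (const [])) (const [])
  exact list_flatMap hU (list_flatMap (hU.comp fst) h.to₂).to₂

theorem closureVia [DecidableEq β] {U vs : α → List β} {r : α → β → β → Bool} (hU : Primrec U)
    (hr : Primrec fun x : α × β × β => r x.1 x.2.1 x.2.2) (hv : Primrec vs) :
    Primrec fun a => _root_.closureVia (U a) (r a) (vs a) := by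
  have h₀ := pairsOf (r := fun a b c => decide (b = c) || r a b c) hU
    (Primrec.or.comp (decide_eq (fst.comp snd) (snd.comp snd)) hr)
  have hacc : Primrec fun x : (α × β × List (β × β)) × β × β => x.1.2.2 :=
    snd.comp (snd.comp fst)
  have hvv : Primrec fun x : (α × β × List (β × β)) × β × β => x.1.2.1 :=
    fst.comp (snd.comp fst)
  have ha : Primrec fun x : (α × β × List (β × β)) × β × β => x.2.1 := fst.comp snd
  have hb : Primrec fun x : (α × β × List (β × β)) × β × β => x.2.2 := snd.comp snd
  have h₁ := pairsOf (r := fun (x : α × β × List (β × β)) a b => decide ((a, b) ∈ x.2.2) ||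
      (decide ((a, x.2.1) ∈ x.2.2) && decide ((x.2.1, b) ∈ x.2.2))) (hU.comp fst)
    (Primrec.or.comp (decide_mem (ha.pair hb) hacc)
      (Primrec.and.comp (decide_mem (ha.pair hvv) hacc) (decide_mem (hvv.pair hb) hacc)))
  exact list_foldr hv h₀ h₁.to₂

theorem absState {A : α → PTA 1} {S : α → List (LinForm × ℤ)} {s : α → ℕ × Threshold}
    (hA : Primrec A) (hS : Primrec S) (hs : Primrec s) :
    Primrec fun a => (A a).absState (S a) (s a) :=
  Primrec.and.comp
    (nat_lt.decide.comp (fst.comp hs) (list_length.comp (pta_inv.comp hA)))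
    (Primrec.and.comp (threshold_leIn hS (const _) (snd.comp hs))
      (constraint_absHolds hS (snd.comp hs) (pta_invariant.comp hA (fst.comp hs))))

theorem absUpdate : Primrec₂ PTA.absUpdate :=
  option_getD.comp (option_map (transition_upd_zero.comp fst) (threshold_const.comp snd).to₂) snd

theorem absFire {S : α → List (LinForm × ℤ)} {t : α → Transition 1} {s s' : α → ℕ × Threshold}
    (hS : Primrec S) (ht : Primrec t) (hs : Primrec s) (hs' : Primrec s') :
    Primrec fun a => PTA.absFire (S a) (t a) (s a) (s' a) := by
  have hu := absUpdate.comp ht (snd.comp hs)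
  exact Primrec.and.comp
    (Primrec.and.comp (decide_eq (transition_src.comp ht) (fst.comp hs))
      (decide_eq (transition_tgt.comp ht) (fst.comp hs')))
    (Primrec.and.comp (constraint_absHolds hS (snd.comp hs) (transition_guard.comp ht))
      (Primrec.and.comp (threshold_leIn hS hu (snd.comp hs'))
        (threshold_leIn hS (snd.comp hs') hu)))

theorem absStep {A : α → PTA 1} {S : α → List (LinForm × ℤ)} {s s' : α → ℕ × Threshold}
    (hA : Primrec A) (hS : Primrec S) (hs : Primrec s) (hs' : Primrec s') :
    Primrec fun a => (A a).absStep (S a) (s a) (s' a) :=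
  Primrec.and.comp (Primrec.and.comp (absState hA hS hs) (absState hA hS hs'))
    (Primrec.or.comp
      (Primrec.and.comp (decide_eq (fst.comp hs') (fst.comp hs))
        (threshold_leIn hS (snd.comp hs) (snd.comp hs')))
      (list_any (pta_trans.comp hA)
        (absFire (hS.comp fst) snd (hs.comp fst) (hs'.comp fst)).to₂))

theorem absUniverse : Primrec₂ PTA.absUniverse :=
  list_flatMap (list_range.comp (list_length.comp (pta_inv.comp fst)))
    (list_map (snd.comp fst) ((snd.comp fst).pair snd).to₂).to₂

theorem absReach {A : α → PTA 1} {S : α → List (LinForm × ℤ)} {l : α → List (Token 1)}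
    (hA : Primrec A) (hS : Primrec S) (hl : Primrec l) :
    Primrec fun a => (A a).absReach (S a) (l a) := by
  have hU := absUniverse.comp hA (pta_thresholds.comp hA hl)
  have hi : Primrec fun a => ((A a).init, Threshold.const 0) :=
    (pta_init.comp hA).pair (const _)
  have hc := closureVia (r := fun a => (A a).absStep (S a)) hU
    (absStep (hA.comp fst) (hS.comp fst) (fst.comp snd) (snd.comp snd)) hU
  exact Primrec.and.comp (absState hA hS hi) (list_any hU (Primrec.and.comp
    (decide_mem ((hi.comp fst).pair snd) (hc.comp fst))
    (stateFormula_absHolds (hS.comp fst) (fst.comp snd) (snd.comp snd) (hl.comp fst))).to₂)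

theorem decomposition : Primrec PTA.decomposition :=
  list_map (signVectors.comp (comparisons.comp (pta_thresholds.comp fst snd)))
    ((snd.pair (const [])).pair (absReach (fst.comp fst) snd (snd.comp fst))).to₂

end Primrec

/-! ### Synthesis and constancy on the regions -/

theorem mainTheorem3 :
    ∃ D : PTA 1 × List (Token 1) → List (LinSystem × Bool),
      Computable D ∧
      ∀ (A : PTA 1) (φ : StateFormula 1), A.WellFormed →
        -- the regions decompose the parameter space
        (∀ γ : ParamVal, ∃ R ∈ D (A, φ.tokens), γ ∈ LinSystem.solutions R.1) ∧
        (D (A, φ.tokens)).Pairwise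
          (fun R R' => Disjoint (LinSystem.solutions R.1) (LinSystem.solutions R'.1)) ∧
        (∀ R ∈ D (A, φ.tokens), LinSystem.params R.1 ⊆ A.params φ) ∧
        -- the regions marked `true` make up the synthesis set
        A.synthesisSet φ =
          {γ | ∃ R ∈ D (A, φ.tokens), R.2 = true ∧ γ ∈ LinSystem.solutions R.1} ∧
        -- feasibility is constant on every region
        ∀ R ∈ D (A, φ.tokens), ∀ γ ∈ LinSystem.solutions R.1, ∀ γ' ∈ LinSystem.solutions R.1,
          (∀ χ : ParamVal → ClockVal 1 → Prop, A.IsRunFormula φ χ →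
            ((∃ ω, χ γ ω) ↔ ∃ ω, χ γ' ω)) ∧
          ∀ τ : List (Transition 1), A.IsSyntacticRun τ →
            ((A.runStates τ γ).Nonempty ↔ (A.runStates τ γ').Nonempty) ∧
            (A.RunSat τ γ φ ↔ A.RunSat τ γ' φ) := by
  refine ⟨PTA.decomposition, Primrec.decomposition.to_comp, fun A φ hA => ?_⟩
  have hmem : ∀ R : LinSystem × Bool, R ∈ PTA.decomposition (A, φ.tokens) ↔
      ∃ S ∈ LinSystem.signVectors (Threshold.comparisons (A.thresholds φ.tokens)),
        ((S, []), A.absReach S φ.tokens) = R := fun R => List.mem_map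
  refine ⟨fun γ => ?_, ?_, ?_, ?_, ?_⟩
  · obtain ⟨S, hS, h⟩ := LinSystem.exists_sat_signVectors _ γ
    exact ⟨_, (hmem _).2 ⟨S, hS, rfl⟩, (LinSystem.mem_solutions_iff S γ).2 h⟩
  · rw [PTA.decomposition, List.pairwise_map]
    refine (LinSystem.signVectors_pairwise _).imp fun h => Set.disjoint_left.2 fun γ h₁ h₂ => ?_
    exact h γ ((LinSystem.mem_solutions_iff _ γ).1 h₁) ((LinSystem.mem_solutions_iff _ γ).1 h₂)
  · intro R hR
    obtain ⟨S, hS, rfl⟩ := (hmem R).1 hR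
    refine LinSystem.params_signVector hS fun r hr => ?_
    simp only [Threshold.comparisons, List.mem_flatMap, List.mem_map] at hr
    obtain ⟨w, hw, w', hw', rfl⟩ := hr
    simpa [Threshold.ineq] using
      ⟨PTA.params_thresholds hw', PTA.params_thresholds hw⟩
  · ext γ
    constructor
    · intro h
      obtain ⟨S, hS, hγ⟩ := LinSystem.exists_sat_signVectors
        (Threshold.comparisons (A.thresholds φ.tokens)) γ
      exact ⟨_, (hmem _).2 ⟨S, hS, rfl⟩, (PTA.absReach_iff hS hγ hA.1).2 h,
        (LinSystem.mem_solutions_iff S γ).2 hγ⟩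
    · rintro ⟨R, hR, h, hγ⟩
      obtain ⟨S, hS, rfl⟩ := (hmem R).1 hR
      exact (PTA.absReach_iff hS ((LinSystem.mem_solutions_iff S γ).1 hγ) hA.1).1 h
  · intro R hR γ hγ γ' hγ'
    obtain ⟨S, hS, rfl⟩ := (hmem R).1 hR
    rw [LinSystem.mem_solutions_iff] at hγ hγ'
    have ho := sameOrder_of_sat hS hγ hγ'
    -- The transfer lemmas go in one direction; exchanging the two valuations gives the converses.
    have ho' := sameOrder_of_sat hS hγ' hγ
    exact ⟨fun χ hχ => ⟨PTA.exists_runFormula_transfer ho hχ,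
        PTA.exists_runFormula_transfer ho' hχ⟩,
      fun τ _ => ⟨⟨PTA.runStates_nonempty_transfer ho, PTA.runStates_nonempty_transfer ho'⟩,
        ⟨PTA.runSat_transfer ho, PTA.runSat_transfer ho'⟩⟩⟩
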